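/- Let $H$ be a (real or complex) separable Hilbert space and let $A=A^*$ be a self-adjoint operator in $H$ with domain $D(A)$ and $(Ah,h)\ge C\|h\|^2$ for all $h\in D(A)$ and some $C>0$. Assume that $A$ has a complete orthonormal system of eigenvectors $v_k$, $k\in\mathbb N$, with eigenvalues $0<\lambda_1\le\lambda_2\le\dots\to+\infty$; write $h_k=(h,v_k)$. Let $\rho\in(0,1]$ and $$E_{\rho,\mu}(z)=\sum_{n=0}^\infty \frac{z^n}{\Gamma(\rho n+\mu)} .$$ The Caputo derivative is $$D_t^\rho u(t)=\frac1{\Gamma(1-\rho)}\int_0^t\frac{u'(\xi)}{(t-\xi)^{\rho}}\,d\xi\quad(0<\rho<1),\qquad D_t^1u=u',$$ where $u$ is assumed differentiable on $(0,t)$ and the integral is improper at $\xi=0$, i.e. it is the limit as $\varepsilon\downarrow0$ of the (Bochner) integrals over $(\varepsilon,t)$. For $\rho=1$ and $t=T$ the derivative is one-sided. For $T>0$, $g:[0,T]\to\mathbb R$ and $\varphi,\psi\in H$, a solution of the inverse problem is a pair $\{u,f\}$ with $f\in H$, $u\in C([0,T];H)$, $D_t^\rho u,\,Au\in C((0,T];H)$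 such that $$D_t^\rho u(t)+Au(t)=g(t)f\quad (0<t\le T),\qquad u(0)=\varphi,\qquad \int_0^Tu(t)\,dt=\psi .$$ Put $$p_{k,\rho}(T)=\int_0^T g(\eta)(T-\eta)^\rho E_{\rho,\rho+1}(-\lambda_k(T-\eta)^\rho)\,d\eta,\qquad q_{k,\rho}(t)=\int_0^t (t-\eta)^{\rho-1} E_{\rho,\rho}(-\lambda_k(t-\eta)^\rho)g(\eta)\,d\eta,$$ and $B_{0,\rho}=\{k:\ p_{k,\rho}(T)=0\}$, $B_\rho=\mathbb N\setminus B_{0,\rho}$. **Theorem.** Let $T_0>0$ and let $g\in C^1[0,T_0]$ be real-valued with $g(0)\ne0$ ($g$ may change sign). There is $m_0>0$, which does not depend on $\varphi$ and $\psi$, such that the following holds for every $T\in(0,T_0]$ with $T\le m_0$, and more generally for every $T\in(0,T_0]$ with $T\le m_0$ or $\int_0^T g(t)\,dt\neq0$, and for all $\varphi\in H$, $\psi\in D(A)$. 1) If $B_{0,\rho}$ is empty, then the inverse problem has a solution $\{u,f\}$, it is unique ($u$ being considered on $[0,T]$), and $$f=\sum_{k=1}^\infty a_kv_k,\qquad u(t)=\sum_{k=1}^\infty\bigl[\varphi_kE_{\rho,1}(-\lambda_kt^\rho)+a_k\,q_{k,\rho}(t)\bigr]v_k\quad(0\le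 t\le T),\tag{$*$}$$ where $a_k=\dfrac{1}{p_{k,\rho}(T)}\bigl[\psi_k-\varphi_kTE_{\rho,2}(-\lambda_kT^\rho)\bigr]$; both series converge in $H$. 2) If $B_{0,\rho}$ is not empty, then a solution exists if and only if $$\psi_k=\varphi_kTE_{\rho,2}(-\lambda_kT^\rho)\quad\text{for all }k\in B_{0,\rho}.$$ If this condition is satisfied, the solution is not unique (there are solutions with different $f$): for every choice of scalars $f_k$, $k\in B_{0,\rho}$, there is a solution $\{u,f\}$ given by $(*)$ with $a_k=\frac{1}{p_{k,\rho}(T)}\bigl[\psi_k-\varphi_kTE_{\rho,2}(-\lambda_kT^\rho)\bigr]$ for $k\in B_\rho$ and $a_k=f_k$ for $k\in B_{0,\rho}$; and every solution is of this form for some scalars $f_k$, $k\in B_{0,\rho}$. -/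

import Mathlib

open Set Filter Topology MeasureTheory

noncomputable section

/-- The two-parameter Mittag-Leffler function `E_{ρ,μ}(z) = ∑ zⁿ / Γ(ρ n + μ)` at a real
argument. -/
def mittagLeffler (ρ μ z : ℝ) : ℝ :=
  ∑' n : ℕ, z ^ n / Real.Gamma (ρ * n + μ)

/-- The kernel integral `q(t) = ∫₀ᵗ (t - η)^(ρ-1) E_{ρ,ρ}(-l (t - η)^ρ) g(η) dη`: the solution of
`D^ρ q + l q = g`, `q(0) = 0`. -/
def sourceResponse (ρ l : ℝ) (g : ℝ → ℝ) (t : ℝ) : ℝ :=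
  ∫ η in (0 : ℝ)..t,
    (t - η) ^ (ρ - 1) * mittagLeffler ρ ρ (-l * (t - η) ^ ρ) * g η

/-- `p(T) = ∫₀ᵀ g(η) (T - η)^ρ E_{ρ,ρ+1}(-l (T - η)^ρ) dη`. -/
def pCoeff (ρ l : ℝ) (g : ℝ → ℝ) (T : ℝ) : ℝ :=
  ∫ η in (0 : ℝ)..T,
    g η * (T - η) ^ ρ * mittagLeffler ρ (ρ + 1) (-l * (T - η) ^ ρ)

/-- `u`, a function on `[0, T]` with values in a Banach space, has the Caputo derivative `w` of
order `ρ ∈ (0, 1]` at `t ∈ (0, T]`.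

For `ρ = 1` this is the classical derivative (one-sided at `t = T`). For `ρ < 1` it says that `u`
is differentiable on `(0, t)` and
`w = 1 / Γ(1 - ρ) * ∫₀ᵗ (t - ξ)^(-ρ) u'(ξ) dξ`,
where the integral is improper at `0`: it is the limit of the (Bochner) integrals over `(ε, t)`
as `ε ↓ 0`. -/
def HasCaputoDerivAt {H : Type*} [NormedAddCommGroup H] [NormedSpace ℝ H]
    (ρ T : ℝ) (u : ℝ → H) (w : H) (t : ℝ) : Prop :=
  if ρ = 1 then
    HasDerivWithinAt u w (Icc 0 T) t
  else
    (∀ ξ ∈ Ioo 0 t, DifferentiableAt ℝ u ξ) ∧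
    (∀ ε ∈ Ioo 0 t,
      IntervalIntegrable (fun ξ => (t - ξ) ^ (-ρ) • deriv u ξ) volume ε t) ∧
    Tendsto
      (fun ε : ℝ => (Real.Gamma (1 - ρ))⁻¹ • ∫ ξ in ε..t, (t - ξ) ^ (-ρ) • deriv u ξ)
      (𝓝[>] 0) (𝓝 w)

/-- The pair `(u, f)` is a solution of the inverse problem
`D^ρ u(t) + A u(t) = g(t) f` on `(0, T]`, `u(0) = φ`, `∫₀ᵀ u(t) dt = ψ`. -/
structure IsInverseSolution {𝕜 H : Type*} [RCLike 𝕜] [NormedAddCommGroup H]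
    [InnerProductSpace 𝕜 H] [NormedSpace ℝ H]
    (A : H →ₗ.[𝕜] H) (ρ T : ℝ) (g : ℝ → ℝ) (φ ψ : H) (u : ℝ → H) (f : H) : Prop where
  /-- `u ∈ C([0, T]; H)` -/
  continuousOn : ContinuousOn u (Icc 0 T)
  /-- `D^ρ u` and `A u` exist on `(0, T]`, are continuous there (they are called `w` and `z`),
  and satisfy the equation. -/
  equation : ∃ w z : ℝ → H, ContinuousOn w (Ioc 0 T) ∧ ContinuousOn z (Ioc 0 T) ∧
    ∀ t ∈ Ioc 0 T, HasCaputoDerivAt ρ T u (w t) t ∧ (u t, z t) ∈ A.graph ∧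
      w t + z t = g t • f
  initial : u 0 = φ
  integral : ∫ t in (0 : ℝ)..T, u t = ψ

/-- The residual `ψ_k - φ_k T E_{ρ,2}(-λ_k T^ρ)`, with `h_k = (h, v_k)`. -/
def fourierResidual {𝕜 H : Type*} [RCLike 𝕜] [NormedAddCommGroup H] [InnerProductSpace 𝕜 H]
    (v : HilbertBasis ℕ 𝕜 H) (lam : ℕ → ℝ) (ρ T : ℝ) (φ ψ : H) (k : ℕ) : 𝕜 :=
  inner 𝕜 (v k) ψ -
    inner 𝕜 (v k) φ * ((T * mittagLeffler ρ 2 (-lam k * T ^ ρ) : ℝ) : 𝕜)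

/-- The pair `(u, f)` is given on `[0, T]` by the Fourier series with source coefficients `a k`:
`f = ∑ a_k v_k` and `u(t) = ∑ [φ_k E_{ρ,1}(-λ_k t^ρ) + a_k q_k(t)] v_k`. -/
def IsGivenBySeries {𝕜 H : Type*} [RCLike 𝕜] [NormedAddCommGroup H] [InnerProductSpace 𝕜 H]
    (v : HilbertBasis ℕ 𝕜 H) (lam : ℕ → ℝ) (ρ T : ℝ) (g : ℝ → ℝ) (φ : H) (a : ℕ → 𝕜)
    (u : ℝ → H) (f : H) : Prop :=
  HasSum (fun k => a k • v k) f ∧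
  ∀ t ∈ Icc 0 T, HasSum (fun k =>
    (inner 𝕜 (v k) φ * ((mittagLeffler ρ 1 (-lam k * t ^ ρ) : ℝ) : 𝕜) +
      a k * ((sourceResponse ρ (lam k) g t : ℝ) : 𝕜)) • v k) (u t)

end

/-!
The problem is diagonal in the eigenbasis `v`. With `l = λ_k`, the `k`-th coordinate of a solution
satisfies the scalar Caputo equation `D^ρ y + l y = g f_k`, `y(0) = φ_k`, and the overdetermination
`∫₀ᵀ u = ψ` becomes `p_k(T) f_k = ψ_k - φ_k T E_{ρ,2}(-λ_k T^ρ)`. So the theorem follows from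

* the solution of the scalar equation. Its building blocks are the kernels
  `mlKernel ρ μ l t = t^(μ-1) E_{ρ,μ}(-l t^ρ)`, which fractional integration maps into
  one another (`integral_rpow_mul_mlKernel`, a termwise Beta integral); together with associativity
  of the Volterra convolution this gives `D^ρ y = -l y` and `D^ρ q = g - l q`
  (`hasCaputoDerivAt_mlKernel_one`, `hasCaputoDerivAt_sourceResponse`);
* a maximum principle: at a maximum over `[0, t]` attained at `t`, the Caputo derivative is
  nonnegative (`HasCaputoDerivAt.nonneg_of_forall_le`). The resulting comparison principle
  `caputo_comparison` gives uniqueness for the scalar equation, including functions whose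
  derivative is not integrable at `0`;
* bounds on the kernels that are uniform in `l`. Comparison shows that the response to a
  nonnegative source is nonnegative and decreases in `l`, and testing with bump functions
  transfers both properties to the kernel `t^(ρ-1) E_{ρ,ρ}(-l t^ρ)`. Hence
  `l t^(ρ-1) E_{ρ,ρ}(-l t^ρ) ≤ ρ / t` and `l E_{ρ,1}(-l t^ρ) ≤ Γ(ρ+1) / t^ρ`
  (`mul_mlKernel_self_le`, `mul_rpow_mul_mlKernel_one_le`);
* strong convergence of diagonal operators: multipliers that converge one by one and are uniformly
  bounded converge as operators (`tendsto_diagMul`). This single fact gives continuity and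
  differentiability of the series in `H` and convergence of the improper integral in the Caputo
  derivative (`hasCaputoDerivAt_diagMul`), even though `u'` is only of order `1 / t` at `0`.

That the coefficients `a_k` belong to a vector of `H` uses `ψ ∈ D(A)`, the boundedness of
`λ_k T E_{ρ,2}(-λ_k T^ρ)`, and `λ_k p_k(T) → ∫₀ᵀ g ≠ 0` (`exists_source`). The condition `T ≤ m₀`
is used only to ensure `∫₀ᵀ g ≠ 0`: `g` has constant sign on `[0, m₀)`.
-/

/-! ### The Mittag-Leffler function -/

/-- The Gamma function grows faster than every exponential. -/
theorem rpow_mul_exp_le_Gamma {R x : ℝ} (hR : 1 ≤ R) (hx : 1 ≤ x) :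
    R ^ (x - 1) * Real.exp (-(R + 1)) ≤ Real.Gamma x := by
  have hx0 : 0 < x := by linarith
  rw [Real.Gamma_eq_integral hx0]
  have hint := Real.GammaIntegral_convergent hx0
  have hsub : Ioc R (R + 1) ⊆ Ioi (0 : ℝ) := fun t ht => by
    have := ht.1; simp only [mem_Ioi]; linarith
  calc R ^ (x - 1) * Real.exp (-(R + 1))
      = ∫ _ in Ioc R (R + 1), R ^ (x - 1) * Real.exp (-(R + 1)) := by simp
    _ ≤ ∫ t in Ioc R (R + 1), Real.exp (-t) * t ^ (x - 1) := by
        refine setIntegral_mono_on (integrableOn_const (by simp)) (hint.mono_set hsub)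
          measurableSet_Ioc fun t ht => ?_
        rw [mul_comm]
        exact mul_le_mul (Real.exp_le_exp.2 (by linarith [ht.2]))
          (Real.rpow_le_rpow (by linarith) ht.1.le (by linarith)) (by positivity) (by positivity)
    _ ≤ ∫ t in Ioi 0, Real.exp (-t) * t ^ (x - 1) := by
        refine setIntegral_mono_set hint ?_ hsub.eventuallyLE
        filter_upwards [ae_restrict_mem measurableSet_Ioi] with t ht
        have : (0 : ℝ) < t := ht
        positivity

theorem Gamma_mul_natCast_add_pos {ρ μ : ℝ} (hρ : 0 < ρ) (hμ : 0 < μ) (n : ℕ) :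
    0 < Real.Gamma (ρ * n + μ) := Real.Gamma_pos_of_pos (by positivity)

theorem summable_mittagLeffler_norm {ρ μ : ℝ} (hρ : 0 < ρ) (hμ : 0 < μ) (z : ℝ) :
    Summable fun n : ℕ => |z| ^ n / Real.Gamma (ρ * n + μ) := by
  -- with `R ^ ρ ≥ 2 |z|` the terms decay at least like `2 ^ (-n)`
  obtain ⟨R, hR1, hRz⟩ : ∃ R : ℝ, 1 ≤ R ∧ 2 * |z| + 1 ≤ R ^ ρ := by
    refine ((eventually_ge_atTop 1).and
      ((tendsto_rpow_atTop hρ).eventually_ge_atTop (2 * |z| + 1))).exists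
  have hR0 : 0 < R := by linarith
  have hRρ : 0 < R ^ ρ := by positivity
  set C := Real.exp (-(R + 1)) * R ^ (μ - 1) with hC
  have hC0 : 0 < C := by positivity
  have hg : Summable fun n : ℕ => C⁻¹ * (1 / 2 : ℝ) ^ n :=
    (summable_geometric_of_lt_one (by norm_num) (by norm_num)).mul_left _
  refine Summable.of_norm_bounded_eventually_nat hg ?_
  filter_upwards [(tendsto_natCast_atTop_atTop (R := ℝ)).eventually_ge_atTop ((1 - μ) / ρ)]
    with n hn
  have hx : 1 ≤ ρ * n + μ := by
    have := (div_le_iff₀ hρ).1 hn; linarith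
  have hΓ := rpow_mul_exp_le_Gamma hR1 hx
  have hpow : R ^ (ρ * n + μ - 1) = (R ^ ρ) ^ n * R ^ (μ - 1) := by
    rw [← Real.rpow_natCast, ← Real.rpow_mul hR0.le, ← Real.rpow_add hR0]; congr 1; ring
  rw [Real.norm_of_nonneg (div_nonneg (by positivity) (Gamma_mul_natCast_add_pos hρ hμ n).le)]
  calc |z| ^ n / Real.Gamma (ρ * n + μ)
      ≤ |z| ^ n / ((R ^ ρ) ^ n * C) := by
        gcongr
        rw [hpow] at hΓ
        rw [hC]; linarith
    _ = C⁻¹ * (|z| / R ^ ρ) ^ n := by rw [div_pow]; field_simp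
    _ ≤ C⁻¹ * (1 / 2 : ℝ) ^ n := by
        refine mul_le_mul_of_nonneg_left (pow_le_pow_left₀ (by positivity) ?_ n) (by positivity)
        rw [div_le_iff₀ hRρ]; linarith

theorem summable_mittagLeffler {ρ μ : ℝ} (hρ : 0 < ρ) (hμ : 0 < μ) (z : ℝ) :
    Summable fun n : ℕ => z ^ n / Real.Gamma (ρ * n + μ) := by
  refine Summable.of_norm ((summable_mittagLeffler_norm hρ hμ z).congr fun n => ?_)
  rw [norm_div, norm_pow, Real.norm_eq_abs,
    Real.norm_of_nonneg (Gamma_mul_natCast_add_pos hρ hμ n).le]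

theorem continuous_mittagLeffler {ρ μ : ℝ} (hρ : 0 < ρ) (hμ : 0 < μ) :
    Continuous (mittagLeffler ρ μ) := by
  rw [continuous_iff_continuousAt]
  intro z
  have hc : ContinuousOn (mittagLeffler ρ μ) (Metric.ball 0 (|z| + 1)) := by
    refine continuousOn_tsum (u := fun n : ℕ => |(|z| + 1)| ^ n / Real.Gamma (ρ * n + μ))
      (fun n => by fun_prop) (summable_mittagLeffler_norm hρ hμ _) ?_
    intro n x hx
    have hx' : |x| ≤ |(|z| + 1)| := by
      rw [abs_of_nonneg (by positivity : (0 : ℝ) ≤ |z| + 1)]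
      simpa using (mem_ball_zero_iff.1 hx).le
    have := Gamma_mul_natCast_add_pos hρ hμ n
    rw [norm_div, norm_pow, Real.norm_eq_abs, Real.norm_of_nonneg this.le]
    gcongr
  exact hc.continuousAt (Metric.isOpen_ball.mem_nhds (by simp))

/-- The recurrence obtained by splitting off the term `n = 0`. -/
theorem mittagLeffler_shift {ρ μ : ℝ} (hρ : 0 < ρ) (hμ : 0 < μ) (z : ℝ) :
    mittagLeffler ρ μ z = (Real.Gamma μ)⁻¹ + z * mittagLeffler ρ (ρ + μ) z := by
  unfold mittagLeffler
  rw [(summable_mittagLeffler hρ hμ z).tsum_eq_zero_add, ← tsum_mul_left]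
  congr 1
  · simp
  · refine tsum_congr fun n => ?_
    rw [pow_succ]
    push_cast
    rw [show ρ * ((n : ℝ) + 1) + μ = ρ * n + (ρ + μ) by ring]
    ring

theorem mittagLeffler_zero {ρ μ : ℝ} (hρ : 0 < ρ) (hμ : 0 < μ) :
    mittagLeffler ρ μ 0 = (Real.Gamma μ)⁻¹ := by
  rw [mittagLeffler_shift hρ hμ]; simp

/-! ### Beta integrals and the Mittag-Leffler kernels -/

theorem intervalIntegrable_sub_rpow {a : ℝ} (ha : 0 < a) (t b c : ℝ) :
    IntervalIntegrable (fun s : ℝ => (t - s) ^ (a - 1)) volume b c := by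
  have := (intervalIntegral.intervalIntegrable_rpow' (a := t - b) (b := t - c) (r := a - 1)
    (by linarith)).comp_sub_left t
  simpa using this

theorem intervalIntegrable_beta {a b t : ℝ} (ha : 0 < a) (hb : 0 < b) (ht : 0 < t) :
    IntervalIntegrable (fun s : ℝ => (t - s) ^ (a - 1) * s ^ (b - 1)) volume 0 t := by
  refine IntervalIntegrable.trans (b := t / 2) ?_ ?_
  · refine IntervalIntegrable.continuousOn_mul
      (intervalIntegral.intervalIntegrable_rpow' (by linarith)) ?_
    rw [uIcc_of_le (by linarith)]
    refine ContinuousOn.rpow_const (by fun_prop) fun x hx => Or.inl ?_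
    have := hx.2
    exact ne_of_gt (by linarith)
  · refine IntervalIntegrable.mul_continuousOn (intervalIntegrable_sub_rpow ha _ _ _) ?_
    rw [uIcc_of_le (by linarith)]
    refine ContinuousOn.rpow_const (by fun_prop) fun x hx => Or.inl ?_
    have := hx.1
    exact ne_of_gt (by linarith)

theorem integral_beta {a b t : ℝ} (ha : 0 < a) (hb : 0 < b) (ht : 0 < t) :
    ∫ s in (0 : ℝ)..t, (t - s) ^ (a - 1) * s ^ (b - 1)
      = Real.Gamma a * Real.Gamma b / Real.Gamma (a + b) * t ^ (a + b - 1) := by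
  have h := Complex.betaIntegral_scaled b a ht
  rw [Complex.betaIntegral_eq_Gamma_mul_div _ _ (by simpa using hb) (by simpa using ha)] at h
  rw [← Complex.ofReal_add, Complex.Gamma_ofReal, Complex.Gamma_ofReal, Complex.Gamma_ofReal] at h
  have hl : (∫ x in (0 : ℝ)..t, (x : ℂ) ^ ((b : ℂ) - 1) * ((t : ℂ) - x) ^ ((a : ℂ) - 1))
      = ((∫ s in (0 : ℝ)..t, (t - s) ^ (a - 1) * s ^ (b - 1) : ℝ) : ℂ) := by
    rw [← intervalIntegral.integral_ofReal]
    refine intervalIntegral.integral_congr fun s hs => ?_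
    rw [uIcc_of_le ht.le] at hs
    rw [Complex.ofReal_mul, Complex.ofReal_cpow hs.1, Complex.ofReal_cpow (by linarith [hs.2])]
    push_cast
    ring
  rw [hl] at h
  have hr : ((t : ℂ) ^ (((b + a : ℝ) : ℂ) - 1)) = ((t ^ (a + b - 1) : ℝ) : ℂ) := by
    rw [Complex.ofReal_cpow ht.le, add_comm b a]; push_cast; rfl
  rw [hr] at h
  have h2 : (∫ s in (0 : ℝ)..t, (t - s) ^ (a - 1) * s ^ (b - 1))
     = t ^ (a + b - 1) * (Real.Gamma b * Real.Gamma a / Real.Gamma (b + a)) := by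
    exact_mod_cast h
  rw [h2, add_comm b a]; ring

/-- The kernel `s ↦ s^(μ-1) E_{ρ,μ}(-l s^ρ)`. For `μ = ρ` it is the resolvent kernel of
`D^ρ + l`, for `μ = 1` it is the solution of `D^ρ y + l y = 0`, `y(0) = 1`. -/
noncomputable def mlKernel (ρ μ l s : ℝ) : ℝ := s ^ (μ - 1) * mittagLeffler ρ μ (-l * s ^ ρ)

theorem continuous_mittagLeffler_comp {ρ μ : ℝ} (hρ : 0 < ρ) (hμ : 0 < μ) (l : ℝ) :
    Continuous fun s : ℝ => mittagLeffler ρ μ (-l * s ^ ρ) :=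
  (continuous_mittagLeffler hρ hμ).comp
    (continuous_const.mul (Real.continuous_rpow_const hρ.le))

theorem continuousOn_mlKernel {ρ μ : ℝ} (hρ : 0 < ρ) (hμ : 0 < μ) (l : ℝ) :
    ContinuousOn (mlKernel ρ μ l) (Ioi 0) := by
  refine ContinuousOn.mul ?_ (continuous_mittagLeffler_comp hρ hμ l).continuousOn
  exact ContinuousOn.rpow_const continuousOn_id fun x hx => Or.inl (ne_of_gt hx)

theorem continuous_mlKernel {ρ μ : ℝ} (hρ : 0 < ρ) (hμ : 1 ≤ μ) (l : ℝ) :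
    Continuous (mlKernel ρ μ l) :=
  (Real.continuous_rpow_const (by linarith)).mul
    (continuous_mittagLeffler_comp hρ (by linarith) l)

theorem intervalIntegrable_mlKernel {ρ μ : ℝ} (hρ : 0 < ρ) (hμ : 0 < μ) (l a b : ℝ) :
    IntervalIntegrable (mlKernel ρ μ l) volume a b :=
  (intervalIntegral.intervalIntegrable_rpow' (by linarith)).mul_continuousOn
    (continuous_mittagLeffler_comp hρ hμ l).continuousOn

theorem intervalIntegrable_rpow_mul_mlKernel {ρ α β t : ℝ} (hρ : 0 < ρ) (hα : 0 < α) (hβ : 0 < β)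
    (l : ℝ) (ht : 0 < t) :
    IntervalIntegrable (fun s => (t - s) ^ (α - 1) * mlKernel ρ β l s) volume 0 t := by
  refine ((intervalIntegrable_beta hα hβ ht).mul_continuousOn
    (continuous_mittagLeffler_comp hρ hβ l).continuousOn).congr fun s _ => ?_
  simp only [mlKernel]; ring

/-- Fractional integration of order `α` takes the kernel of index `β` to the kernel of
index `α + β`. -/
theorem integral_rpow_mul_mlKernel {ρ α β t : ℝ} (hρ : 0 < ρ) (hα : 0 < α) (hβ : 0 < β)
    (l : ℝ) (ht : 0 < t) :
    ∫ s in (0 : ℝ)..t, (t - s) ^ (α - 1) * mlKernel ρ β l s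
      = Real.Gamma α * mlKernel ρ (α + β) l t := by
  have hbn : ∀ n : ℕ, 0 < ρ * n + β := fun n => by positivity
  set B : ℕ → ℝ → ℝ := fun n s => (t - s) ^ (α - 1) * s ^ (ρ * n + β - 1) with hB
  have hBint : ∀ n, IntegrableOn (B n) (Ioc 0 t) := fun n =>
    (intervalIntegrable_iff_integrableOn_Ioc_of_le ht.le).1 (intervalIntegrable_beta hα (hbn n) ht)
  have hBval : ∀ n, ∫ s in Ioc 0 t, B n s = Real.Gamma α * Real.Gamma (ρ * n + β)
      / Real.Gamma (ρ * n + (α + β)) * (t ^ (α + β - 1) * (t ^ ρ) ^ n) := fun n => by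
    rw [← intervalIntegral.integral_of_le ht.le, integral_beta hα (hbn n) ht]
    rw [← Real.rpow_natCast (t ^ ρ), ← Real.rpow_mul ht.le, ← Real.rpow_add ht]
    congr 2 <;> [congr 1; skip] <;> ring
  have hval : ∀ (c : ℝ) (n : ℕ), c ^ n / Real.Gamma (ρ * n + β) * ∫ s in Ioc 0 t, B n s
      = Real.Gamma α * t ^ (α + β - 1) * ((c * t ^ ρ) ^ n / Real.Gamma (ρ * n + (α + β))) := by
    intro c n
    rw [hBval, mul_pow]
    have := (Gamma_mul_natCast_add_pos hρ hβ n).ne'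
    field_simp
  set F : ℕ → ℝ → ℝ := fun n s => (-l) ^ n / Real.Gamma (ρ * n + β) * B n s with hF
  have hFint : ∀ n, Integrable (F n) (volume.restrict (Ioc 0 t)) := fun n => (hBint n).const_mul _
  have hsum : Summable fun n => ∫ s in Ioc 0 t, ‖F n s‖ := by
    have : ∀ n, ∫ s in Ioc 0 t, ‖F n s‖ =
        Real.Gamma α * t ^ (α + β - 1) * (|l * t ^ ρ| ^ n / Real.Gamma (ρ * n + (α + β))) := by
      intro n
      have h1 : ∫ s in Ioc 0 t, ‖F n s‖ =
          ∫ s in Ioc 0 t, |l| ^ n / Real.Gamma (ρ * n + β) * B n s := by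
        refine setIntegral_congr_fun measurableSet_Ioc fun s hs => ?_
        have h2 : 0 ≤ B n s :=
          mul_nonneg (Real.rpow_nonneg (by linarith [hs.2]) _) (Real.rpow_nonneg hs.1.le _)
        simp only [hF]
        rw [norm_mul, norm_div, norm_pow, norm_neg, Real.norm_eq_abs,
          Real.norm_of_nonneg (Gamma_mul_natCast_add_pos hρ hβ n).le, Real.norm_of_nonneg h2]
      rw [h1, integral_const_mul, hval, abs_mul, abs_of_nonneg (Real.rpow_nonneg ht.le ρ)]
    simp_rw [this]
    exact (summable_mittagLeffler_norm hρ (by positivity) _).mul_left _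
  have key := hasSum_integral_of_summable_integral_norm hFint hsum
  have hlim : ∫ s in Ioc 0 t, ∑' n, F n s
      = ∫ s in Ioc 0 t, (t - s) ^ (α - 1) * mlKernel ρ β l s := by
    refine setIntegral_congr_fun measurableSet_Ioc fun s hs => ?_
    simp only [hF, hB, mlKernel, mittagLeffler]
    rw [← tsum_mul_left, ← tsum_mul_left]
    refine tsum_congr fun n => ?_
    rw [show ρ * n + β - 1 = (β - 1) + ρ * n by ring, Real.rpow_add hs.1, Real.rpow_mul hs.1.le,
      Real.rpow_natCast, mul_pow]
    ring
  rw [intervalIntegral.integral_of_le ht.le, ← hlim, ← key.tsum_eq]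
  simp only [hF, mlKernel, mittagLeffler]
  rw [← tsum_mul_left, ← tsum_mul_left]
  refine tsum_congr fun n => ?_
  rw [integral_const_mul, hval]
  ring

theorem integral_mlKernel {ρ β t : ℝ} (hρ : 0 < ρ) (hβ : 0 < β) (l : ℝ) (ht : 0 ≤ t) :
    ∫ s in (0 : ℝ)..t, mlKernel ρ β l s = mlKernel ρ (β + 1) l t := by
  rcases ht.eq_or_lt with rfl | ht
  · simp [mlKernel, Real.zero_rpow hβ.ne']
  · have := integral_rpow_mul_mlKernel hρ one_pos hβ l ht
    simpa [add_comm] using this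

/-- The identity `E_{ρ,1}(-l t^ρ) = 1 - l t^ρ E_{ρ,ρ+1}(-l t^ρ)`. -/
theorem mlKernel_one_eq {ρ : ℝ} (hρ : 0 < ρ) (l t : ℝ) :
    mlKernel ρ 1 l t = 1 - l * mlKernel ρ (ρ + 1) l t := by
  simp only [mlKernel, sub_self, Real.rpow_zero, one_mul]
  rw [mittagLeffler_shift hρ one_pos]
  simp
  ring

theorem mlKernel_one_zero {ρ : ℝ} (hρ : 0 < ρ) (l : ℝ) : mlKernel ρ 1 l 0 = 1 := by
  simp [mlKernel, Real.zero_rpow hρ.ne', mittagLeffler_zero hρ one_pos]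

theorem hasDerivAt_mlKernel_add_one {ρ t : ℝ} (hρ : 0 < ρ) (l : ℝ) (ht : 0 < t) :
    HasDerivAt (mlKernel ρ (ρ + 1) l) (mlKernel ρ ρ l t) t := by
  have h := intervalIntegral.integral_hasDerivAt_right
    (intervalIntegrable_mlKernel hρ hρ l 0 t)
    ((continuousOn_mlKernel hρ hρ l).stronglyMeasurableAtFilter isOpen_Ioi t ht)
    ((continuousOn_mlKernel hρ hρ l).continuousAt (Ioi_mem_nhds ht))
  refine h.congr_of_eventuallyEq ?_
  filter_upwards [Ioi_mem_nhds ht] with s hs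
  exact (integral_mlKernel hρ hρ l (le_of_lt hs)).symm

theorem hasDerivAt_mlKernel_one {ρ t : ℝ} (hρ : 0 < ρ) (l : ℝ) (ht : 0 < t) :
    HasDerivAt (mlKernel ρ 1 l) (-l * mlKernel ρ ρ l t) t := by
  have h := ((hasDerivAt_mlKernel_add_one hρ l ht).const_mul l).const_sub 1
  have h2 : mlKernel ρ 1 l = fun s => 1 - l * mlKernel ρ (ρ + 1) l s :=
    funext fun s => mlKernel_one_eq hρ l s
  rw [h2]
  exact h.congr_deriv (neg_mul _ _).symm

/-! ### Volterra convolution on the half-line -/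

/-- The Volterra convolution `(a * b)(t) = ∫₀ᵗ a(t - s) b(s) ds`. -/
noncomputable def volterra (a b : ℝ → ℝ) (t : ℝ) : ℝ := ∫ s in (0 : ℝ)..t, a (t - s) * b s

theorem volterra_comm (a b : ℝ → ℝ) : volterra a b = volterra b a := by
  funext t
  have := intervalIntegral.integral_comp_sub_left (a := 0) (b := t)
    (fun s => b (t - s) * a s) t
  simp only [sub_sub_cancel, sub_self, sub_zero] at this
  rw [volterra, volterra, ← this]
  exact intervalIntegral.integral_congr fun s _ => mul_comm _ _

theorem volterra_congr {a a' b b' : ℝ → ℝ} {t : ℝ} (ht : 0 ≤ t)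
    (ha : ∀ s ∈ Ioo 0 t, a s = a' s) (hb : ∀ s ∈ Ioo 0 t, b s = b' s) :
    volterra a b t = volterra a' b' t := by
  refine intervalIntegral.integral_congr_Ioo_of_le ht fun s hs => ?_
  rw [ha (t - s) ⟨by linarith [hs.2], by linarith [hs.1]⟩, hb s hs]

/-- The whole-line convolution of truncations to `(0, R]` agrees with the Volterra convolution
on `(-∞, R]`. -/
theorem convolution_indicator_eq_volterra (a b : ℝ → ℝ) {s R : ℝ} (hs : s ∈ Ioc 0 R) :
    (convolution ((Ioc 0 R).indicator a) ((Ioc 0 R).indicator b)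
      (ContinuousLinearMap.mul ℝ ℝ) volume) s = volterra b a s := by
  have h0 : ∀ f : ℝ → ℝ, (Ioi (0 : ℝ)).indicator ((Ioc 0 R).indicator f) = (Ioc 0 R).indicator f :=
    fun f => by
      rw [indicator_indicator, inter_eq_right.2 Ioc_subset_Ioi_self]
  have := posConvolution_eq_convolution_indicator ((Ioc 0 R).indicator a)
    ((Ioc 0 R).indicator b) (ContinuousLinearMap.mul ℝ ℝ) volume
  rw [h0, h0] at this
  rw [← this, posConvolution, indicator_of_mem (show s ∈ Ioi (0 : ℝ) from hs.1)]
  refine intervalIntegral.integral_congr_Ioo_of_le hs.1.le fun x hx => ?_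
  simp only [ContinuousLinearMap.mul_apply']
  rw [indicator_of_mem (show x ∈ Ioc 0 R from ⟨hx.1, by linarith [hx.2, hs.2]⟩),
    indicator_of_mem (show s - x ∈ Ioc 0 R from ⟨by linarith [hx.2], by linarith [hx.1, hs.2]⟩),
    mul_comm]

theorem volterra_assoc {a b c : ℝ → ℝ} {t : ℝ} (ht : 0 ≤ t)
    (ha : IntervalIntegrable a volume 0 t) (hb : IntervalIntegrable b volume 0 t)
    (hc : ContinuousOn c (Icc 0 t)) :
    volterra a (volterra b c) t = volterra (volterra a b) c t := by
  rcases ht.eq_or_lt with rfl | ht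
  · simp [volterra]
  obtain ⟨M, hM⟩ := isCompact_Icc.exists_bound_of_continuousOn hc
  set A := (Ioc 0 t).indicator a
  set B := (Ioc 0 t).indicator b
  set C := (Ioc 0 t).indicator c
  have hA : Integrable A := (integrable_indicator_iff measurableSet_Ioc).2
    ((intervalIntegrable_iff_integrableOn_Ioc_of_le ht.le).1 ha)
  have hB : Integrable B := (integrable_indicator_iff measurableSet_Ioc).2
    ((intervalIntegrable_iff_integrableOn_Ioc_of_le ht.le).1 hb)
  have hC : Integrable C := (integrable_indicator_iff measurableSet_Ioc).2
    ((hc.integrableOn_Icc).mono_set Ioc_subset_Icc_self)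
  have hM0 : 0 ≤ M := (norm_nonneg _).trans (hM 0 ⟨le_rfl, ht.le⟩)
  have hCM : ∀ x, ‖C x‖ ≤ M := fun x => by
    by_cases hx : x ∈ Ioc 0 t
    · simp only [C, indicator_of_mem hx]; exact hM x (Ioc_subset_Icc_self hx)
    · simp only [C, indicator_of_notMem hx, norm_zero]; exact hM0
  -- `|B| ⋆ |C|` is bounded because `C` is, which makes the triple convolution absolutely convergent
  have hBC : Integrable (convolution (fun x => ‖B x‖) (fun x => ‖C x‖)
      (ContinuousLinearMap.mul ℝ ℝ) volume) :=
    hB.norm.integrable_convolution (ContinuousLinearMap.mul ℝ ℝ) hC.norm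
  have hBCM : ∀ x, ‖(convolution (fun x => ‖B x‖) (fun x => ‖C x‖)
      (ContinuousLinearMap.mul ℝ ℝ) volume) x‖ ≤ (∫ s, ‖B s‖) * M := fun x => by
    rw [convolution_def, ← integral_mul_const]
    refine norm_integral_le_of_norm_le (hB.norm.mul_const _) (Eventually.of_forall fun s => ?_)
    simp only [ContinuousLinearMap.mul_apply', norm_mul, norm_norm]
    exact mul_le_mul_of_nonneg_left (hCM _) (norm_nonneg _)
  have key := convolution_assoc (f := A) (g := B) (k := C) (μ := volume) (ν := volume) (x₀ := t)
    (ContinuousLinearMap.mul ℝ ℝ) (ContinuousLinearMap.mul ℝ ℝ) (ContinuousLinearMap.mul ℝ ℝ)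
    (ContinuousLinearMap.mul ℝ ℝ) (fun x y z => by simp [mul_assoc])
    hA.1 hB.1 hC.1 (hA.ae_convolution_exists _ hB)
    (hB.norm.ae_convolution_exists _ hC.norm) (by
      refine (hA.norm.mul_bdd (c := (∫ s, ‖B s‖) * M) (hBC.comp_sub_left t).1
        (Eventually.of_forall fun x => hBCM _)))
  have htt : t ∈ Ioc 0 t := ⟨ht, le_rfl⟩
  have hl : (convolution (convolution A B (ContinuousLinearMap.mul ℝ ℝ) volume) C
      (ContinuousLinearMap.mul ℝ ℝ) volume) t = volterra c (volterra b a) t := by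
    rw [← convolution_indicator_eq_volterra (volterra b a) c htt, convolution_def, convolution_def]
    refine integral_congr_ae (Eventually.of_forall fun s => ?_)
    simp only [ContinuousLinearMap.mul_apply']
    by_cases hs : s ∈ Ioc 0 t
    · rw [indicator_of_mem hs, convolution_indicator_eq_volterra a b hs]
    · rw [indicator_of_notMem hs]
      rcases not_and_or.1 hs with h | h
      · have : t - s ∉ Ioc 0 t ∨ s = 0 := by
          rcases (not_lt.1 h).eq_or_lt with h | h
          · exact Or.inr h
          · exact Or.inl fun h' => by linarith [h'.2]
        rcases this with h' | rfl
        · simp [C, indicator_of_notMem h']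
        · have : (convolution A B (ContinuousLinearMap.mul ℝ ℝ) volume) 0 = 0 := by
            rw [convolution_def]
            refine integral_eq_zero_of_ae (Eventually.of_forall fun x => ?_)
            simp only [ContinuousLinearMap.mul_apply', Pi.zero_apply]
            by_cases hx : x ∈ Ioc 0 t
            · have : (0 - x) ∉ Ioc 0 t := fun h' => by linarith [h'.1, hx.1]
              simp only [B, indicator_of_notMem this, mul_zero]
            · simp [A, indicator_of_notMem hx]
          rw [this]
      · have : t - s ∉ Ioc 0 t := fun h' => by linarith [h'.1, not_le.1 h]
        simp [C, indicator_of_notMem this]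
  have hr : (convolution A (convolution B C (ContinuousLinearMap.mul ℝ ℝ) volume)
      (ContinuousLinearMap.mul ℝ ℝ) volume) t = volterra (volterra c b) a t := by
    rw [← convolution_indicator_eq_volterra a (volterra c b) htt, convolution_def, convolution_def]
    refine integral_congr_ae ?_
    -- the point `x = t`, where the truncated convolution need not agree, is negligible
    filter_upwards [compl_mem_ae_iff.2 (measure_singleton t)] with x hx
    simp only [ContinuousLinearMap.mul_apply']
    by_cases hxs : x ∈ Ioc 0 t
    · have : t - x ∈ Ioc 0 t :=
        ⟨sub_pos.2 (lt_of_le_of_ne hxs.2 hx), by linarith [hxs.1]⟩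
      rw [indicator_of_mem this, convolution_indicator_eq_volterra b c this]
    · simp [A, indicator_of_notMem hxs]
  rw [hl, hr] at key
  rw [volterra_comm a, volterra_comm b c, volterra_comm (volterra a b) c, volterra_comm a b, key]

/-- The Volterra convolution of an integrable and a continuous function is continuous. -/
theorem continuousOn_volterra {K c : ℝ → ℝ} {R : ℝ} (hR : 0 ≤ R)
    (hK : IntervalIntegrable K volume 0 R) (hc : Continuous c) :
    ContinuousOn (volterra K c) (Icc 0 R) := by
  rw [volterra_comm]
  obtain ⟨M, hM⟩ := isCompact_Icc.exists_bound_of_continuousOn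
    (hc.continuousOn (s := Icc (-R) R))
  -- the moving endpoint is turned into an indicator, continuous in `t` away from `t = s`
  set F : ℝ → ℝ → ℝ := fun t s => (Iic t).indicator (fun s => c (t - s) * K s) s with hF
  have hM0 : 0 ≤ M := (norm_nonneg _).trans (hM 0 ⟨by linarith, hR⟩)
  have heq : ∀ t ∈ Icc 0 R, volterra c K t = ∫ s in (0 : ℝ)..R, F t s := by
    intro t ht
    simp only [hF]
    rw [intervalIntegral.integral_of_le hR, integral_indicator measurableSet_Iic,
      Measure.restrict_restrict measurableSet_Iic, volterra, intervalIntegral.integral_of_le ht.1]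
    congr 2
    ext s
    simp only [mem_Ioc, mem_inter_iff, mem_Iic]
    exact ⟨fun h => ⟨h.2, h.1, h.2.trans ht.2⟩, fun h => ⟨h.2.1, h.1⟩⟩
  have hKm : AEStronglyMeasurable K (volume.restrict (uIoc 0 R)) :=
    hK.aestronglyMeasurable_restrict_uIoc
  intro t₀ ht₀
  refine ContinuousWithinAt.congr ?_ heq (heq t₀ ht₀)
  refine intervalIntegral.continuousWithinAt_of_dominated_interval
    (bound := fun s => M * ‖K s‖) ?_ ?_ (hK.norm.const_mul M) ?_
  · refine Eventually.of_forall fun t => ?_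
    refine AEStronglyMeasurable.indicator ?_ measurableSet_Iic
    exact (by fun_prop : Continuous fun s => c (t - s)).aestronglyMeasurable.mul hKm
  · filter_upwards [self_mem_nhdsWithin] with t ht
    refine Eventually.of_forall fun s hs => ?_
    rw [uIoc_of_le hR] at hs
    simp only [hF]
    refine (norm_indicator_le_norm_self _ _).trans ?_
    rw [norm_mul]
    exact mul_le_mul_of_nonneg_right
      (hM _ ⟨by linarith [ht.1, hs.2], by linarith [ht.2, hs.1]⟩) (norm_nonneg _)
  · filter_upwards [compl_mem_ae_iff.2 (measure_singleton t₀)] with s hs _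
    refine ContinuousAt.continuousWithinAt ?_
    rcases lt_or_gt_of_ne hs with h | h
    · have : (fun t => F t s) =ᶠ[𝓝 t₀] fun t => c (t - s) * K s := by
        filter_upwards [Ioi_mem_nhds h] with t ht
        simp only [hF]
        rw [indicator_of_mem (mem_Iic.2 (le_of_lt (mem_Ioi.1 ht)))]
      exact ContinuousAt.congr (by fun_prop) this.symm
    · have : (fun t => F t s) =ᶠ[𝓝 t₀] fun _ => (0 : ℝ) := by
        filter_upwards [Iio_mem_nhds h] with t ht
        simp only [hF]
        rw [indicator_of_notMem fun h' => absurd (mem_Iic.1 h') (not_le.2 (mem_Iio.1 ht))]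
      exact ContinuousAt.congr continuousAt_const this.symm

theorem intervalIntegrable_volterra {K c : ℝ → ℝ} {R : ℝ} (hR : 0 ≤ R)
    (hK : IntervalIntegrable K volume 0 R) (hc : Continuous c) :
    IntervalIntegrable (volterra K c) volume 0 R := by
  refine ContinuousOn.intervalIntegrable ?_
  rw [uIcc_of_le hR]; exact continuousOn_volterra hR hK hc

theorem intervalIntegrable_sub_mul {K c : ℝ → ℝ} {t : ℝ}
    (hK : IntervalIntegrable K volume 0 t) (hc : Continuous c) :
    IntervalIntegrable (fun s => K (t - s) * c s) volume 0 t := by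
  have h := (hK.comp_sub_left t).symm
  simp only [sub_self, sub_zero] at h
  exact h.mul_continuousOn hc.continuousOn

/-- `K * c` is the primitive of `c(0) K + K * c'`. -/
theorem volterra_eq_integral {K c c' : ℝ → ℝ} {t : ℝ} (ht : 0 ≤ t)
    (hK : IntervalIntegrable K volume 0 t)
    (hc : ∀ s, HasDerivAt c (c' s) s) (hc' : Continuous c') :
    volterra K c t = ∫ s in (0 : ℝ)..t, (c 0 * K s + volterra K c' s) := by
  have hcc : ∀ s, c s = c 0 + volterra (fun _ => 1) c' s := fun s => by
    have := intervalIntegral.integral_eq_sub_of_hasDerivAt (a := 0) (b := s)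
      (fun x _ => hc x) (hc'.intervalIntegrable _ _)
    simp only [volterra, one_mul, this]; ring
  have hprim : Continuous (volterra (fun _ => 1) c') := by
    have : volterra (fun _ => 1) c' = fun s => c s - c 0 := funext fun s => by
      rw [hcc s]; ring
    rw [this]
    exact (continuous_iff_continuousAt.2 fun s => (hc s).continuousAt).sub continuous_const
  have h1 : volterra K c t = c 0 * (∫ s in (0 : ℝ)..t, K s)
      + volterra K (volterra (fun _ => 1) c') t := by
    have hK' : IntervalIntegrable (fun s => K (t - s)) volume 0 t := by
      simpa using intervalIntegrable_sub_mul hK (continuous_const (y := (1 : ℝ)))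
    have hsub : ∫ s in (0 : ℝ)..t, K (t - s) = ∫ s in (0 : ℝ)..t, K s := by
      rw [intervalIntegral.integral_comp_sub_left]; simp
    rw [← hsub, volterra, volterra, ← intervalIntegral.integral_const_mul,
      ← intervalIntegral.integral_add (hK'.const_mul _) (intervalIntegrable_sub_mul hK hprim)]
    refine intervalIntegral.integral_congr fun s _ => ?_
    rw [hcc s]; ring
  have hone : IntervalIntegrable (fun _ : ℝ => (1 : ℝ)) volume 0 t := intervalIntegrable_const
  -- `K * (1 * c') = 1 * (K * c')`, as the convolution is associative and commutative
  rw [h1, volterra_assoc ht hK hone hc'.continuousOn, volterra_comm K,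
    ← volterra_assoc ht hone hK hc'.continuousOn,
    intervalIntegral.integral_add (hK.const_mul _) (intervalIntegrable_volterra ht hK hc'),
    intervalIntegral.integral_const_mul]
  simp [volterra]

theorem hasDerivAt_volterra {K c c' : ℝ → ℝ} (hK : ∀ R, IntervalIntegrable K volume 0 R)
    (hKc : ContinuousOn K (Ioi 0)) (hc : ∀ s, HasDerivAt c (c' s) s) (hc' : Continuous c')
    {t : ℝ} (ht : 0 < t) :
    HasDerivAt (volterra K c) (c 0 * K t + volterra K c' t) t := by
  have hcont : ContinuousOn (fun s => c 0 * K s + volterra K c' s) (Ioo 0 (t + 1)) :=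
    ((hKc.mono Ioo_subset_Ioi_self).const_mul _).add
      ((continuousOn_volterra (by linarith) (hK (t + 1)) hc').mono Ioo_subset_Icc_self)
  have hmem : t ∈ Ioo 0 (t + 1) := ⟨ht, by linarith⟩
  have h := intervalIntegral.integral_hasDerivAt_right
    (((hK t).const_mul (c 0)).add (intervalIntegrable_volterra ht.le (hK t) hc'))
    (hcont.stronglyMeasurableAtFilter isOpen_Ioo t hmem)
    (hcont.continuousAt (isOpen_Ioo.mem_nhds hmem))
  refine h.congr_of_eventuallyEq ?_
  filter_upwards [Ioi_mem_nhds ht] with s hs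
  exact volterra_eq_integral (le_of_lt hs) (hK s) hc hc'

/-- Integration by parts for the Volterra convolution. -/
theorem volterra_deriv_swap {y y' c c' : ℝ → ℝ} {t : ℝ} (ht : 0 ≤ t) (hy : Continuous y)
    (hyd : ∀ s, 0 < s → HasDerivAt y (y' s) s) (hy' : IntervalIntegrable y' volume 0 t)
    (hc : ∀ s, HasDerivAt c (c' s) s) (hc' : Continuous c') :
    c 0 * y t + volterra y c' t = y 0 * c t + volterra y' c t := by
  have hyt : IntervalIntegrable (fun s => -y' (t - s)) volume 0 t := by
    have h := (intervalIntegrable_sub_mul hy' (continuous_const (y := (1 : ℝ)))).neg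
    simp only [mul_one] at h
    exact h
  have := intervalIntegral.integral_mul_deriv_eq_deriv_mul_of_hasDeriv_right (a := 0) (b := t)
    (u := fun s => y (t - s)) (u' := fun s => -y' (t - s)) (v := c) (v' := c')
    (by fun_prop) (continuous_iff_continuousAt.2 fun s => (hc s).continuousAt).continuousOn
    (fun x hx => by
      rw [min_eq_left ht, max_eq_right ht] at hx
      exact ((hyd (t - x) (by linarith [hx.2])).comp_const_sub t x).hasDerivWithinAt)
    (fun x _ => (hc x).hasDerivWithinAt) hyt (hc'.intervalIntegrable _ _)
  rw [volterra, this]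
  simp only [sub_self, sub_zero, neg_mul, intervalIntegral.integral_neg, volterra]
  ring

/-! ### The source response -/

theorem sourceResponse_eq_volterra (ρ l : ℝ) (g : ℝ → ℝ) :
    sourceResponse ρ l g = volterra (mlKernel ρ ρ l) g := rfl

theorem pCoeff_eq_volterra (ρ l : ℝ) (g : ℝ → ℝ) :
    pCoeff ρ l g = volterra (mlKernel ρ (ρ + 1) l) g := by
  funext t
  refine intervalIntegral.integral_congr fun s _ => ?_
  simp only [mlKernel, add_sub_cancel_right]
  ring

/-- `p(T)` is the integral of the source response over `[0, T]`. -/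
theorem integral_sourceResponse {ρ t : ℝ} (hρ : 0 < ρ) (l : ℝ) {g : ℝ → ℝ} (ht : 0 ≤ t)
    (hg : ContinuousOn g (Icc 0 t)) :
    ∫ s in (0 : ℝ)..t, sourceResponse ρ l g s = pCoeff ρ l g t := by
  have h := volterra_assoc (a := fun _ => 1) ht intervalIntegrable_const
    (intervalIntegrable_mlKernel hρ hρ l 0 t) hg
  rw [pCoeff_eq_volterra, sourceResponse_eq_volterra]
  rw [show ∫ s in (0 : ℝ)..t, volterra (mlKernel ρ ρ l) g s
    = volterra (fun _ => 1) (volterra (mlKernel ρ ρ l) g) t by simp [volterra], h]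
  refine volterra_congr ht (fun s hs => ?_) fun s _ => rfl
  rw [← integral_mlKernel hρ hρ l hs.1.le]
  simp [volterra]

theorem hasDerivAt_sourceResponse {ρ t : ℝ} (hρ : 0 < ρ) (l : ℝ) {g g' : ℝ → ℝ}
    (hg : ∀ s, HasDerivAt g (g' s) s) (hg' : Continuous g') (ht : 0 < t) :
    HasDerivAt (sourceResponse ρ l g)
      (g 0 * mlKernel ρ ρ l t + volterra (mlKernel ρ ρ l) g' t) t :=
  hasDerivAt_volterra (fun _ => intervalIntegrable_mlKernel hρ hρ l _ _)
    (continuousOn_mlKernel hρ hρ l) hg hg' ht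

theorem mlKernel_mul_add_volterra {ρ t : ℝ} (hρ : 0 < ρ) (l : ℝ) {g g' : ℝ → ℝ}
    (hg : ∀ s, HasDerivAt g (g' s) s) (hg' : Continuous g') (ht : 0 ≤ t) :
    g 0 * mlKernel ρ 1 l t + volterra (mlKernel ρ 1 l) g' t = g t - l * sourceResponse ρ l g t := by
  rw [volterra_deriv_swap ht (continuous_mlKernel hρ le_rfl l)
    (fun s hs => hasDerivAt_mlKernel_one hρ l hs)
    ((intervalIntegrable_mlKernel hρ hρ l 0 t).const_mul (-l)) hg hg', mlKernel_one_zero hρ,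
    sourceResponse_eq_volterra]
  simp only [volterra, one_mul]
  rw [← intervalIntegral.integral_const_mul, sub_eq_add_neg, ← intervalIntegral.integral_neg]
  congr 1
  refine intervalIntegral.integral_congr fun s _ => ?_
  ring

theorem integral_rpow_mul_deriv_sourceResponse {ρ t : ℝ} (hρ : 0 < ρ) (hρ1 : ρ < 1) (l : ℝ)
    {g g' : ℝ → ℝ} (hg : ∀ s, HasDerivAt g (g' s) s) (hg' : Continuous g') (ht : 0 < t) :
    IntervalIntegrable (fun s => (t - s) ^ (-ρ) *
      (g 0 * mlKernel ρ ρ l s + volterra (mlKernel ρ ρ l) g' s)) volume 0 t ∧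
    ∫ s in (0 : ℝ)..t, (t - s) ^ (-ρ) *
      (g 0 * mlKernel ρ ρ l s + volterra (mlKernel ρ ρ l) g' s)
      = Real.Gamma (1 - ρ) * (g t - l * sourceResponse ρ l g t) := by
  have hα : 0 < 1 - ρ := by linarith
  have hexp : -ρ = (1 - ρ) - 1 := by ring
  have hi1 := intervalIntegrable_rpow_mul_mlKernel hρ hα hρ l ht
  rw [← hexp] at hi1
  have hi2 : IntervalIntegrable (fun s => (t - s) ^ (-ρ) * volterra (mlKernel ρ ρ l) g' s)
      volume 0 t := by
    rw [hexp]
    refine (intervalIntegrable_sub_rpow hα _ _ _).mul_continuousOn ?_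
    rw [uIcc_of_le ht.le]
    exact continuousOn_volterra ht.le (intervalIntegrable_mlKernel hρ hρ l _ _) hg'
  have hfun : (fun s => (t - s) ^ (-ρ) *
      (g 0 * mlKernel ρ ρ l s + volterra (mlKernel ρ ρ l) g' s)) =
      fun s => g 0 * ((t - s) ^ (-ρ) * mlKernel ρ ρ l s)
        + (t - s) ^ (-ρ) * volterra (mlKernel ρ ρ l) g' s := by
    funext s; ring
  rw [hfun]
  refine ⟨(hi1.const_mul _).add hi2, ?_⟩
  have hB : ∀ s, 0 < s → ∫ r in (0 : ℝ)..s, (s - r) ^ (-ρ) * mlKernel ρ ρ l r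
      = Real.Gamma (1 - ρ) * mlKernel ρ 1 l s := fun s hs => by
    have := integral_rpow_mul_mlKernel hρ hα hρ l hs
    rwa [← hexp, sub_add_cancel] at this
  rw [intervalIntegral.integral_add (hi1.const_mul _) hi2, intervalIntegral.integral_const_mul,
    hB t ht]
  have hassoc := volterra_assoc (a := fun x => x ^ (-ρ)) (c := g') ht.le
    (intervalIntegral.intervalIntegrable_rpow' (by linarith))
    (intervalIntegrable_mlKernel hρ hρ l 0 t) hg'.continuousOn
  rw [show ∫ s in (0 : ℝ)..t, (t - s) ^ (-ρ) * volterra (mlKernel ρ ρ l) g' s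
    = volterra (fun x => x ^ (-ρ)) (volterra (mlKernel ρ ρ l) g') t from rfl, hassoc,
    volterra_congr (a := volterra (fun x => x ^ (-ρ)) (mlKernel ρ ρ l)) (b := g')
      (a' := fun s => Real.Gamma (1 - ρ) * mlKernel ρ 1 l s) (b' := g') ht.le
      (fun s hs => hB s hs.1) fun s _ => rfl, ← mlKernel_mul_add_volterra hρ l hg hg' ht.le]
  simp only [volterra, mul_assoc, intervalIntegral.integral_const_mul]
  ring

/-! ### The Caputo derivative -/

section Caputo

variable {H : Type*} [NormedAddCommGroup H] [NormedSpace ℝ H]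

theorem hasCaputoDerivAt_one {T t : ℝ} {u : ℝ → H} {w : H} :
    HasCaputoDerivAt 1 T u w t ↔ HasDerivWithinAt u w (Icc 0 T) t := by
  simp [HasCaputoDerivAt]

theorem hasCaputoDerivAt_of_tendsto {ρ T t : ℝ} (hρ1 : ρ < 1) {u u' : ℝ → H} {w : H}
    (ht : 0 < t)
    (hu : ∀ ξ ∈ Ioo 0 t, HasDerivAt u (u' ξ) ξ)
    (hint : ∀ ε ∈ Ioo 0 t, IntervalIntegrable (fun ξ => (t - ξ) ^ (-ρ) • u' ξ) volume ε t)
    (hlim : Tendsto (fun ε : ℝ => ∫ ξ in ε..t, (t - ξ) ^ (-ρ) • u' ξ) (𝓝[>] 0)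
      (𝓝 (Real.Gamma (1 - ρ) • w))) :
    HasCaputoDerivAt ρ T u w t := by
  have heq : ∀ ε ∈ Ioo 0 t, EqOn (fun ξ => (t - ξ) ^ (-ρ) • u' ξ)
      (fun ξ => (t - ξ) ^ (-ρ) • deriv u ξ) (Ioo ε t) := fun ε hε ξ hξ => by
    simp only [(hu ξ ⟨hε.1.trans hξ.1, hξ.2⟩).deriv]
  rw [HasCaputoDerivAt, if_neg hρ1.ne]
  refine ⟨fun ξ hξ => (hu ξ hξ).differentiableAt, fun ε hε => ?_, ?_⟩
  · refine (hint ε hε).congr_uIoo ?_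
    rw [uIoo_of_le hε.2.le]; exact heq ε hε
  · have hΓ : Real.Gamma (1 - ρ) ≠ 0 := (Real.Gamma_pos_of_pos (by linarith)).ne'
    have := hlim.const_smul (Real.Gamma (1 - ρ))⁻¹
    rw [smul_smul, inv_mul_cancel₀ hΓ, one_smul] at this
    refine this.congr' ?_
    filter_upwards [Ioo_mem_nhdsGT ht] with ε hε
    rw [intervalIntegral.integral_congr_Ioo_of_le hε.2.le (heq ε hε)]

theorem HasCaputoDerivAt.clm_apply [CompleteSpace H] {E : Type*} [NormedAddCommGroup E]
    [NormedSpace ℝ E] [CompleteSpace E] {ρ T t : ℝ} (hρ1 : ρ ≤ 1) {u : ℝ → H} {w : H}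
    (h : HasCaputoDerivAt ρ T u w t) (ht : 0 < t) (L : H →L[ℝ] E) :
    HasCaputoDerivAt ρ T (fun s => L (u s)) (L w) t := by
  rcases hρ1.eq_or_lt with rfl | hρ1
  · rw [hasCaputoDerivAt_one] at h ⊢
    exact L.hasFDerivAt.comp_hasDerivWithinAt t h
  · rw [HasCaputoDerivAt, if_neg hρ1.ne] at h
    obtain ⟨hd, hi, hl⟩ := h
    have hΓ : Real.Gamma (1 - ρ) ≠ 0 := (Real.Gamma_pos_of_pos (by linarith)).ne'
    refine hasCaputoDerivAt_of_tendsto hρ1 ht (u' := fun ξ => L (deriv u ξ))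
      (fun ξ hξ => L.hasFDerivAt.comp_hasDerivAt ξ (hd ξ hξ).hasDerivAt) (fun ε hε => ?_) ?_
    · simp only [← map_smul]
      exact ⟨L.integrable_comp (hi ε hε).1, L.integrable_comp (hi ε hε).2⟩
    · have h2 := (((L.continuous.tendsto w).comp hl).const_smul (Real.Gamma (1 - ρ)))
      refine h2.congr' ?_
      filter_upwards [Ioo_mem_nhdsGT ht] with ε hε
      simp only [Function.comp_apply, map_smul]
      rw [smul_smul, mul_inv_cancel₀ hΓ, one_smul,
        ← L.intervalIntegral_comp_comm (hi ε hε)]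
      simp

theorem HasCaputoDerivAt.sub {ρ T t : ℝ} (hρ1 : ρ ≤ 1) {u v : ℝ → H} {w z : H}
    (hu : HasCaputoDerivAt ρ T u w t) (hv : HasCaputoDerivAt ρ T v z t) (ht : 0 < t) :
    HasCaputoDerivAt ρ T (fun s => u s - v s) (w - z) t := by
  rcases hρ1.eq_or_lt with rfl | hρ1
  · rw [hasCaputoDerivAt_one] at hu hv ⊢
    exact HasDerivWithinAt.sub hu hv
  · rw [HasCaputoDerivAt, if_neg hρ1.ne] at hu hv
    obtain ⟨hd, hi, hl⟩ := hu
    obtain ⟨hd', hi', hl'⟩ := hv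
    have hΓ : Real.Gamma (1 - ρ) ≠ 0 := (Real.Gamma_pos_of_pos (by linarith)).ne'
    refine hasCaputoDerivAt_of_tendsto hρ1 ht (u' := fun ξ => deriv u ξ - deriv v ξ)
      (fun ξ hξ => (hd ξ hξ).hasDerivAt.sub (hd' ξ hξ).hasDerivAt) (fun ε hε => ?_) ?_
    · simp only [smul_sub]
      exact (hi ε hε).sub (hi' ε hε)
    · refine ((hl.sub hl').const_smul (Real.Gamma (1 - ρ))).congr' ?_
      filter_upwards [Ioo_mem_nhdsGT ht] with ε hε
      simp only [smul_sub]
      rw [intervalIntegral.integral_sub (hi ε hε) (hi' ε hε), smul_smul, smul_smul,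
        mul_inv_cancel₀ hΓ, one_smul, one_smul]

end Caputo

theorem HasCaputoDerivAt.add_const_mul {ρ T t : ℝ} (hρ1 : ρ ≤ 1) {y z : ℝ → ℝ}
    {w x : ℝ} (hy : HasCaputoDerivAt ρ T y w t) (hz : HasCaputoDerivAt ρ T z x t) (ht : 0 < t)
    (a b : ℝ) :
    HasCaputoDerivAt ρ T (fun s => a * y s + b * z s) (a * w + b * x) t := by
  have h1 := hy.clm_apply hρ1 ht (a • ContinuousLinearMap.id ℝ ℝ)
  have h2 := hz.clm_apply hρ1 ht ((-b) • ContinuousLinearMap.id ℝ ℝ)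
  simpa using h1.sub hρ1 h2 ht

/-! ### The maximum principle -/

/-- The weight `(t - ξ)^(-ρ)` increases in `ξ` and all the increments of `y` up to `t` are
nonnegative, so integration by parts leaves only nonnegative terms. -/
theorem integral_rpow_mul_deriv_nonneg {ρ ε t : ℝ} (hρ0 : 0 < ρ) (hε : ε < t)
    {y y' : ℝ → ℝ} (hc : ContinuousOn y (Icc ε t)) (hd : ∀ ξ ∈ Ico ε t, HasDerivAt y (y' ξ) ξ)
    (hint : IntervalIntegrable (fun ξ => (t - ξ) ^ (-ρ) * y' ξ) volume ε t)
    (hmax : ∀ ξ ∈ Icc ε t, y ξ ≤ y t) :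
    0 ≤ ∫ ξ in ε..t, (t - ξ) ^ (-ρ) * y' ξ := by
  set F : ℝ → ℝ := fun ξ => (t - ξ) ^ (-ρ) * y' ξ with hF
  have hy' : IntervalIntegrable y' volume ε t := by
    have h1 : IntervalIntegrable (fun ξ => F ξ * (t - ξ) ^ ρ) volume ε t :=
      hint.mul_continuousOn ((by fun_prop : ContinuousOn (fun ξ : ℝ => t - ξ) _).rpow_const
        fun x _ => Or.inr hρ0.le)
    refine h1.congr_uIoo fun ξ hξ => ?_
    rw [uIoo_of_le hε.le] at hξ
    have : 0 < t - ξ := sub_pos.2 hξ.2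
    simp only [hF]
    rw [mul_right_comm, ← Real.rpow_add this]; simp
  -- Integration by parts on `[ε, s]`; the boundary term at `s` has the wrong sign, but it is at most
  -- the integral of `‖F‖` over `[s, t]`, which vanishes as `s → t`.
  have hstep : ∀ s ∈ Ioo ε t, 0 ≤ (∫ ξ in ε..s, F ξ) + ∫ ξ in s..t, ‖F ξ‖ := by
    intro s hs
    have hU : ∀ x ∈ uIcc ε s, HasDerivAt (fun ξ : ℝ => (t - ξ) ^ (-ρ))
        (ρ * (t - x) ^ (-ρ - 1)) x := fun x hx => by
      rw [uIcc_of_le hs.1.le] at hx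
      have hpos : t - x ≠ 0 := ne_of_gt (by linarith [hx.2, hs.2])
      have := ((hasDerivAt_id x).const_sub t).rpow_const (p := -ρ) (Or.inl hpos)
      simpa using this
    have hV : ∀ x ∈ uIcc ε s, HasDerivAt (fun ξ => y ξ - y t) (y' x) x := fun x hx => by
      rw [uIcc_of_le hs.1.le] at hx
      exact (hd x ⟨hx.1, hx.2.trans_lt hs.2⟩).sub_const _
    have hUi : IntervalIntegrable (fun x : ℝ => ρ * (t - x) ^ (-ρ - 1)) volume ε s := by
      refine ContinuousOn.intervalIntegrable (ContinuousOn.const_mul ?_ _)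
      refine ContinuousOn.rpow_const (by fun_prop) fun x hx => Or.inl ?_
      rw [uIcc_of_le hs.1.le] at hx
      exact ne_of_gt (by linarith [hx.2, hs.2])
    have hy1 : IntervalIntegrable y' volume ε s := hy'.mono_set (by
      rw [uIcc_of_le hs.1.le, uIcc_of_le hε.le]; exact Icc_subset_Icc_right hs.2.le)
    have hparts := intervalIntegral.integral_mul_deriv_eq_deriv_mul hU hV hUi hy1
    have h1 : ∫ x in ε..s, ρ * (t - x) ^ (-ρ - 1) * (y x - y t) ≤ 0 := by
      rw [← neg_nonneg, ← intervalIntegral.integral_neg]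
      refine intervalIntegral.integral_nonneg hs.1.le fun x hx => ?_
      have h2 : 0 ≤ ρ * (t - x) ^ (-ρ - 1) :=
        mul_nonneg hρ0.le (Real.rpow_nonneg (by linarith [hx.2, hs.2]) _)
      have := hmax x ⟨hx.1, hx.2.trans hs.2.le⟩
      nlinarith
    have h3 : 0 ≤ (t - ε) ^ (-ρ) * (y t - y ε) :=
      mul_nonneg (Real.rpow_nonneg (by linarith) _) (sub_nonneg.2 (hmax ε ⟨le_rfl, hε.le⟩))
    have hy2 : IntervalIntegrable y' volume s t := hy'.mono_set (by
      rw [uIcc_of_le hs.2.le, uIcc_of_le hε.le]; exact Icc_subset_Icc_left hs.1.le)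
    have hF2 : IntervalIntegrable F volume s t := hint.mono_set (by
      rw [uIcc_of_le hs.2.le, uIcc_of_le hε.le]; exact Icc_subset_Icc_left hs.1.le)
    have h4 : (t - s) ^ (-ρ) * (y t - y s) ≤ ∫ ξ in s..t, ‖F ξ‖ := by
      rw [← intervalIntegral.integral_eq_sub_of_hasDerivAt_of_le hs.2.le
        (hc.mono (Icc_subset_Icc_left hs.1.le))
        (fun x hx => hd x ⟨hs.1.le.trans hx.1.le, hx.2⟩) hy2,
        ← intervalIntegral.integral_const_mul]
      refine intervalIntegral.integral_mono_on_of_le_Ioo hs.2.le (hy2.const_mul _) hF2.norm ?_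
      intro x hx
      have hx0 : 0 < t - x := sub_pos.2 hx.2
      simp only [hF]
      rw [norm_mul, Real.norm_of_nonneg (Real.rpow_nonneg hx0.le _)]
      calc (t - s) ^ (-ρ) * y' x ≤ (t - s) ^ (-ρ) * ‖y' x‖ :=
            mul_le_mul_of_nonneg_left (Real.le_norm_self _)
              (Real.rpow_nonneg (by linarith [hs.2]) _)
        _ ≤ (t - x) ^ (-ρ) * ‖y' x‖ :=
            mul_le_mul_of_nonneg_right
              (Real.rpow_le_rpow_of_nonpos hx0 (by linarith [hx.1]) (by linarith)) (norm_nonneg _)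
    have h5 : ∫ ξ in ε..s, F ξ = ∫ x in ε..s, (t - x) ^ (-ρ) * y' x := rfl
    rw [h5, hparts]
    linarith
  have hεt : ε ∈ uIcc ε t := left_mem_uIcc
  have htt : t ∈ uIcc ε t := right_mem_uIcc
  have hc1 : Tendsto (fun s => ∫ ξ in ε..s, F ξ) (𝓝[Ioo ε t] t) (𝓝 (∫ ξ in ε..t, F ξ)) :=
    ((intervalIntegral.continuousOn_primitive_interval' hint hεt) t htt).mono
      (by rw [uIcc_of_le hε.le]; exact Ioo_subset_Icc_self)
  have hc2 : Tendsto (fun s => ∫ ξ in s..t, ‖F ξ‖) (𝓝[Ioo ε t] t) (𝓝 0) := by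
    have h := ((intervalIntegral.continuousOn_primitive_interval' hint.norm htt) t htt).mono
      (s := Ioo ε t) (by rw [uIcc_of_le hε.le]; exact Ioo_subset_Icc_self)
    have h' : Tendsto (fun s => ∫ ξ in t..s, ‖F ξ‖) (𝓝[Ioo ε t] t)
      (𝓝 (∫ ξ in t..t, ‖F ξ‖)) := h
    rw [intervalIntegral.integral_same] at h'
    have h2 := h'.neg
    rw [neg_zero] at h2
    exact h2.congr fun s => (intervalIntegral.integral_symm _ _).symm
  have : (𝓝[Ioo ε t] t).NeBot := by
    rw [nhdsWithin_Ioo_eq_nhdsLT hε]; infer_instance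
  have hlim := hc1.add hc2
  rw [add_zero] at hlim
  refine ge_of_tendsto hlim ?_
  filter_upwards [self_mem_nhdsWithin] with s hs using hstep s hs

theorem HasCaputoDerivAt.nonneg_of_forall_le {ρ T t : ℝ} (hρ0 : 0 < ρ) (hρ1 : ρ ≤ 1) {y : ℝ → ℝ}
    {w : ℝ} (h : HasCaputoDerivAt ρ T y w t) (ht : t ∈ Ioc 0 T) (hc : ContinuousOn y (Icc 0 t))
    (hmax : ∀ s ∈ Icc 0 t, y s ≤ y t) : 0 ≤ w := by
  rcases hρ1.eq_or_lt with rfl | hρ1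
  · rw [hasCaputoDerivAt_one] at h
    have h1 : HasDerivWithinAt y w (Ioo 0 t) t :=
      h.mono fun x hx => ⟨hx.1.le, hx.2.le.trans ht.2⟩
    rw [hasDerivWithinAt_iff_tendsto_slope' (by simp)] at h1
    have : (𝓝[Ioo 0 t] t).NeBot := by
      rw [nhdsWithin_Ioo_eq_nhdsLT ht.1]; infer_instance
    refine ge_of_tendsto h1 ?_
    filter_upwards [self_mem_nhdsWithin] with s hs
    rw [slope_def_field]
    exact div_nonneg_of_nonpos (sub_nonpos.2 (hmax s ⟨hs.1.le, hs.2.le⟩)) (by linarith [hs.2])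
  · rw [HasCaputoDerivAt, if_neg hρ1.ne] at h
    obtain ⟨hd, hi, hl⟩ := h
    refine ge_of_tendsto hl ?_
    filter_upwards [Ioo_mem_nhdsGT ht.1] with ε hε
    refine smul_nonneg (inv_nonneg.2 (Real.Gamma_pos_of_pos (by linarith)).le) ?_
    simp only [smul_eq_mul]
    exact integral_rpow_mul_deriv_nonneg hρ0 hε.2 (hc.mono (Icc_subset_Icc_left hε.1.le))
      (fun ξ hξ => (hd ξ ⟨hε.1.trans_le hξ.1, hξ.2⟩).hasDerivAt) (hi ε hε)
      fun ξ hξ => hmax ξ ⟨hε.1.le.trans hξ.1, hξ.2⟩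

/-- The comparison principle: `D^ρ y + l y ≤ 0` and `y(0) ≤ 0` imply `y ≤ 0`, because
`D^ρ y ≥ 0` at a positive maximum of `y`. -/
theorem caputo_comparison {ρ T l : ℝ} (hρ0 : 0 < ρ) (hρ1 : ρ ≤ 1) (hl : 0 < l) {y w : ℝ → ℝ}
    (hc : ContinuousOn y (Icc 0 T)) (h : ∀ t ∈ Ioc 0 T, HasCaputoDerivAt ρ T y (w t) t)
    (hle : ∀ t ∈ Ioc 0 T, w t + l * y t ≤ 0) (h0 : y 0 ≤ 0) : ∀ t ∈ Icc 0 T, y t ≤ 0 := by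
  intro t₁ ht₁
  by_contra! hpos
  obtain ⟨t, ht, hmax⟩ := isCompact_Icc.exists_isMaxOn ⟨t₁, ht₁⟩ hc
  have hyt : 0 < y t := hpos.trans_le (hmax ht₁)
  have ht0 : t ∈ Ioc 0 T := by
    refine ⟨lt_of_le_of_ne ht.1 ?_, ht.2⟩
    rintro rfl
    linarith
  have hw := (h t ht0).nonneg_of_forall_le hρ0 hρ1 ht0 (hc.mono (Icc_subset_Icc_right ht.2))
    fun s hs => hmax ⟨hs.1, hs.2.trans ht.2⟩
  have := hle t ht0
  nlinarith

/-- Uniqueness for `D^ρ y + l y = h`, `y(0)` given. No integrability of `y'` at `0` is needed. -/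
theorem caputo_unique {ρ T l : ℝ} (hρ0 : 0 < ρ) (hρ1 : ρ ≤ 1) (hl : 0 < l) {y z w x : ℝ → ℝ}
    (hy : ContinuousOn y (Icc 0 T)) (hz : ContinuousOn z (Icc 0 T))
    (hyw : ∀ t ∈ Ioc 0 T, HasCaputoDerivAt ρ T y (w t) t)
    (hzx : ∀ t ∈ Ioc 0 T, HasCaputoDerivAt ρ T z (x t) t)
    (heq : ∀ t ∈ Ioc 0 T, w t + l * y t = x t + l * z t) (h0 : y 0 = z 0) :
    EqOn y z (Icc 0 T) := by
  intro t ht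
  have h1 := caputo_comparison hρ0 hρ1 hl (hy.sub hz)
    (fun t ht => (hyw t ht).sub hρ1 (hzx t ht) ht.1)
    (fun t ht => by have := heq t ht; simp only [Pi.sub_apply]; linarith)
    (by simp [h0]) t ht
  have h2 := caputo_comparison hρ0 hρ1 hl (hz.sub hy)
    (fun t ht => (hzx t ht).sub hρ1 (hyw t ht) ht.1)
    (fun t ht => by have := heq t ht; simp only [Pi.sub_apply]; linarith)
    (by simp [h0]) t ht
  simp only [Pi.sub_apply] at h1 h2
  linarith

/-! ### The scalar equation -/

/-- For an integrable integrand the improper integral at `0` is the integral. -/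
theorem tendsto_integral_nhdsGT_zero {t : ℝ} (ht : 0 < t) {F : ℝ → ℝ}
    (hF : IntervalIntegrable F volume 0 t) :
    Tendsto (fun ε => ∫ ξ in ε..t, F ξ) (𝓝[>] 0) (𝓝 (∫ ξ in (0 : ℝ)..t, F ξ)) := by
  have h := ((intervalIntegral.continuousOn_primitive_interval' hF right_mem_uIcc) 0
    left_mem_uIcc).mono (s := Ioo 0 t) (by rw [uIcc_of_le ht.le]; exact Ioo_subset_Icc_self)
  rw [ContinuousWithinAt, nhdsWithin_Ioo_eq_nhdsGT ht] at h
  have h2 := h.neg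
  rw [← intervalIntegral.integral_symm] at h2
  exact h2.congr fun s => (intervalIntegral.integral_symm _ _).symm

theorem hasCaputoDerivAt_of_integral {ρ T t I : ℝ} (hρ1 : ρ < 1) {y y' : ℝ → ℝ}
    (ht : 0 < t) (hd : ∀ ξ ∈ Ioo 0 t, HasDerivAt y (y' ξ) ξ)
    (hint : IntervalIntegrable (fun ξ => (t - ξ) ^ (-ρ) * y' ξ) volume 0 t)
    (hI : ∫ ξ in (0 : ℝ)..t, (t - ξ) ^ (-ρ) * y' ξ = Real.Gamma (1 - ρ) * I) :
    HasCaputoDerivAt ρ T y I t := by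
  refine hasCaputoDerivAt_of_tendsto hρ1 ht hd (fun ε hε => hint.mono_set ?_) ?_
  · rw [uIcc_of_le hε.2.le, uIcc_of_le ht.le]; exact Icc_subset_Icc_left hε.1.le
  · simp only [smul_eq_mul]
    rw [← hI]
    exact tendsto_integral_nhdsGT_zero ht hint

theorem hasCaputoDerivAt_mlKernel_one {ρ T t : ℝ} (hρ0 : 0 < ρ) (hρ1 : ρ ≤ 1) (l : ℝ)
    (ht : 0 < t) :
    HasCaputoDerivAt ρ T (mlKernel ρ 1 l) (-l * mlKernel ρ 1 l t) t := by
  rcases hρ1.eq_or_lt with rfl | hρ1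
  · rw [hasCaputoDerivAt_one]
    exact (hasDerivAt_mlKernel_one one_pos l ht).hasDerivWithinAt
  · have hα : 0 < 1 - ρ := by linarith
    have hi := (intervalIntegrable_rpow_mul_mlKernel hρ0 hα hρ0 l ht).const_mul (-l)
    have hI := integral_rpow_mul_mlKernel hρ0 hα hρ0 l ht
    rw [sub_add_cancel] at hI
    have hf : (fun s => -l * ((t - s) ^ (1 - ρ - 1) * mlKernel ρ ρ l s))
        = fun s => (t - s) ^ (-ρ) * (-l * mlKernel ρ ρ l s) := by
      funext s; rw [show 1 - ρ - 1 = -ρ by ring]; ring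
    rw [hf] at hi
    refine hasCaputoDerivAt_of_integral hρ1 ht
      (fun ξ hξ => hasDerivAt_mlKernel_one hρ0 l hξ.1) hi ?_
    rw [← hf, intervalIntegral.integral_const_mul, hI]
    ring

theorem hasCaputoDerivAt_sourceResponse {ρ T t : ℝ} (hρ0 : 0 < ρ) (hρ1 : ρ ≤ 1) (l : ℝ)
    {g g' : ℝ → ℝ} (hg : ∀ s, HasDerivAt g (g' s) s) (hg' : Continuous g') (ht : 0 < t) :
    HasCaputoDerivAt ρ T (sourceResponse ρ l g) (g t - l * sourceResponse ρ l g t) t := by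
  rcases hρ1.eq_or_lt with rfl | hρ1
  · rw [hasCaputoDerivAt_one, ← mlKernel_mul_add_volterra one_pos l hg hg' ht.le]
    exact (hasDerivAt_sourceResponse one_pos l hg hg' ht).hasDerivWithinAt
  · obtain ⟨hi, hI⟩ := integral_rpow_mul_deriv_sourceResponse hρ0 hρ1 l hg hg' ht
    exact hasCaputoDerivAt_of_integral hρ1 ht
      (fun ξ hξ => hasDerivAt_sourceResponse hρ0 l hg hg' hξ.1) hi hI

/-! ### Sign, monotonicity and decay of the kernels -/

theorem continuousOn_sourceResponse {ρ : ℝ} (hρ : 0 < ρ) (l : ℝ) {g : ℝ → ℝ} (hg : Continuous g)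
    {T : ℝ} (hT : 0 ≤ T) : ContinuousOn (sourceResponse ρ l g) (Icc 0 T) :=
  continuousOn_volterra hT (intervalIntegrable_mlKernel hρ hρ l _ _) hg

theorem sourceResponse_zero (ρ l : ℝ) (g : ℝ → ℝ) : sourceResponse ρ l g 0 = 0 := by
  simp [sourceResponse]

theorem mlKernel_one_nonneg {ρ l t : ℝ} (hρ0 : 0 < ρ) (hρ1 : ρ ≤ 1) (hl : 0 < l) (ht : 0 ≤ t) :
    0 ≤ mlKernel ρ 1 l t := by
  have h := caputo_comparison hρ0 hρ1 hl (T := t)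
    (y := fun s => -1 * mlKernel ρ 1 l s + 0 * mlKernel ρ 1 l s)
    (by have := continuous_mlKernel hρ0 le_rfl l; fun_prop)
    (fun s hs => (hasCaputoDerivAt_mlKernel_one hρ0 hρ1 l hs.1).add_const_mul hρ1
      (hasCaputoDerivAt_mlKernel_one hρ0 hρ1 l hs.1) hs.1 (-1) 0)
    (fun s _ => le_of_eq (by ring)) (by simp [mlKernel_one_zero hρ0]) t ⟨ht, le_rfl⟩
  linarith

theorem sourceResponse_nonneg {ρ l t : ℝ} (hρ0 : 0 < ρ) (hρ1 : ρ ≤ 1) (hl : 0 < l) (ht : 0 ≤ t)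
    {g g' : ℝ → ℝ} (hg : ∀ s, HasDerivAt g (g' s) s) (hg' : Continuous g') (h0 : ∀ s, 0 ≤ g s) :
    0 ≤ sourceResponse ρ l g t := by
  have hgc : Continuous g := continuous_iff_continuousAt.2 fun s => (hg s).continuousAt
  have hq := continuousOn_sourceResponse hρ0 l hgc ht
  have h := caputo_comparison hρ0 hρ1 hl (T := t)
    (y := fun s => -1 * sourceResponse ρ l g s + 0 * sourceResponse ρ l g s)
    (by fun_prop)
    (fun s hs => (hasCaputoDerivAt_sourceResponse hρ0 hρ1 l hg hg' hs.1).add_const_mul hρ1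
      (hasCaputoDerivAt_sourceResponse hρ0 hρ1 l hg hg' hs.1) hs.1 (-1) 0)
    (fun s _ => by have := h0 s; ring_nf; linarith) (by simp [sourceResponse_zero]) t ⟨ht, le_rfl⟩
  linarith

theorem sourceResponse_le_of_le {ρ l m t : ℝ} (hρ0 : 0 < ρ) (hρ1 : ρ ≤ 1) (hl : 0 < l)
    (hlm : l ≤ m) (ht : 0 ≤ t)
    {g g' : ℝ → ℝ} (hg : ∀ s, HasDerivAt g (g' s) s) (hg' : Continuous g') (h0 : ∀ s, 0 ≤ g s) :
    sourceResponse ρ m g t ≤ sourceResponse ρ l g t := by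
  have hgc : Continuous g := continuous_iff_continuousAt.2 fun s => (hg s).continuousAt
  have hq := continuousOn_sourceResponse hρ0 l hgc ht
  have hq' := continuousOn_sourceResponse hρ0 m hgc ht
  have h := caputo_comparison hρ0 hρ1 hl (T := t)
    (y := fun s => 1 * sourceResponse ρ m g s + (-1) * sourceResponse ρ l g s)
    (by fun_prop)
    (fun s hs => (hasCaputoDerivAt_sourceResponse hρ0 hρ1 m hg hg' hs.1).add_const_mul hρ1
      (hasCaputoDerivAt_sourceResponse hρ0 hρ1 l hg hg' hs.1) hs.1 1 (-1))
    (fun s hs => by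
      have := sourceResponse_nonneg hρ0 hρ1 (hl.trans_le hlm) hs.1.le hg hg' h0
      nlinarith) (by simp [sourceResponse_zero]) t ⟨ht, le_rfl⟩
  linarith

/-- A kernel whose Volterra convolution with every nonnegative `C¹` function is nonnegative is
itself nonnegative: test with bump functions. -/
theorem nonneg_of_volterra_nonneg {K : ℝ → ℝ} (hK : ∀ R, IntervalIntegrable K volume 0 R)
    (hKc : ContinuousOn K (Ioi 0)) {s₀ : ℝ} (hs₀ : 0 < s₀)
    (h : ∀ g : ℝ → ℝ, ContDiff ℝ 1 g → (∀ x, 0 ≤ g x) → 0 ≤ volterra K g (2 * s₀)) :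
    0 ≤ K s₀ := by
  by_contra! hneg
  have hev : ∀ᶠ x in 𝓝 s₀, K x < 0 :=
    (hKc.continuousAt (Ioi_mem_nhds hs₀)).eventually (Iio_mem_nhds hneg)
  obtain ⟨r, hr, hball⟩ := Metric.eventually_nhds_iff_ball.1 (hev.and (Ioi_mem_nhds hs₀))
  let f : ContDiffBump s₀ := ⟨r / 2, r, by linarith, by linarith⟩
  have hfsupp : Function.support f = Metric.ball s₀ r := f.support_eq
  have hf0 := h f f.contDiff fun x => f.nonneg
  have hi : IntervalIntegrable (fun s => -(K (2 * s₀ - s) * f s)) volume 0 (2 * s₀) :=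
    (intervalIntegrable_sub_mul (hK _) f.continuous).neg
  have hsub : ∀ s ∈ Metric.ball s₀ r, K (2 * s₀ - s) < 0 ∧ s < 2 * s₀ := fun s hs => by
    have hmem : 2 * s₀ - s ∈ Metric.ball s₀ r := by
      rw [Metric.mem_ball, Real.dist_eq] at hs ⊢
      rw [abs_sub_comm] at hs
      convert hs using 2
      ring
    have := hball _ hmem
    exact ⟨this.1, by have h2 : 0 < 2 * s₀ - s := this.2; linarith⟩
  have hpos : 0 < ∫ s in (0 : ℝ)..2 * s₀, -(K (2 * s₀ - s) * f s) := by
    rw [intervalIntegral.integral_pos_iff_support_of_nonneg_ae ?_ hi]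
    · refine ⟨by linarith, (Metric.measure_ball_pos volume s₀ hr).trans_le (measure_mono ?_)⟩
      intro s hs
      refine ⟨?_, (hball s hs).2, (hsub s hs).2.le⟩
      have : s ∈ Function.support f := hfsupp ▸ hs
      exact neg_ne_zero.2 (mul_ne_zero (hsub s hs).1.ne this)
    · refine Eventually.of_forall fun s => ?_
      simp only [Pi.zero_apply]
      by_cases hs : s ∈ Metric.ball s₀ r
      · have := (hsub s hs).1
        have := f.nonneg (x := s)
        nlinarith
      · have : f s = 0 := by
          rw [← hfsupp] at hs
          exact Function.notMem_support.1 hs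
        simp [this]
  rw [intervalIntegral.integral_neg] at hpos
  rw [volterra] at hf0
  linarith

theorem ContDiff.hasDerivAt_deriv {g : ℝ → ℝ} (hg : ContDiff ℝ 1 g) (s : ℝ) :
    HasDerivAt g (deriv g s) s := (hg.differentiable one_ne_zero s).hasDerivAt

section Kernel

variable {ρ l t : ℝ}

theorem mlKernel_self_nonneg (hρ0 : 0 < ρ) (hρ1 : ρ ≤ 1) (hl : 0 < l) (ht : 0 < t) :
    0 ≤ mlKernel ρ ρ l t :=
  nonneg_of_volterra_nonneg (fun _ => intervalIntegrable_mlKernel hρ0 hρ0 l _ _)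
    (continuousOn_mlKernel hρ0 hρ0 l) ht fun _ hg h0 =>
      sourceResponse_nonneg hρ0 hρ1 hl (by linarith) hg.hasDerivAt_deriv
        (hg.continuous_deriv le_rfl) h0

theorem mlKernel_self_le_of_le {m : ℝ} (hρ0 : 0 < ρ) (hρ1 : ρ ≤ 1) (hl : 0 < l) (hlm : l ≤ m)
    (ht : 0 < t) : mlKernel ρ ρ m t ≤ mlKernel ρ ρ l t := by
  have hil := fun R => intervalIntegrable_mlKernel hρ0 hρ0 l 0 R
  have him := fun R => intervalIntegrable_mlKernel hρ0 hρ0 m 0 R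
  refine sub_nonneg.1 (nonneg_of_volterra_nonneg
    (K := fun s => mlKernel ρ ρ l s - mlKernel ρ ρ m s) (fun R => (hil R).sub (him R))
    ((continuousOn_mlKernel hρ0 hρ0 l).sub (continuousOn_mlKernel hρ0 hρ0 m)) ht
    fun g hg h0 => ?_)
  have h := sourceResponse_le_of_le hρ0 hρ1 hl hlm (by linarith : 0 ≤ 2 * t) hg.hasDerivAt_deriv
    (hg.continuous_deriv le_rfl) h0
  rw [sourceResponse_eq_volterra, sourceResponse_eq_volterra, volterra, volterra] at h
  simp only [volterra, sub_mul]
  rw [intervalIntegral.integral_sub (intervalIntegrable_sub_mul (hil _) hg.continuous)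
    (intervalIntegrable_sub_mul (him _) hg.continuous)]
  linarith

theorem mittagLeffler_self_neg_antitone {a b : ℝ} (hρ0 : 0 < ρ) (hρ1 : ρ ≤ 1) (ha : 0 < a)
    (hab : a ≤ b) : mittagLeffler ρ ρ (-b) ≤ mittagLeffler ρ ρ (-a) := by
  simpa [mlKernel] using mlKernel_self_le_of_le hρ0 hρ1 ha hab one_pos

theorem mlKernel_one_le_one (hρ0 : 0 < ρ) (hρ1 : ρ ≤ 1) (hl : 0 < l) (ht : 0 ≤ t) :
    mlKernel ρ 1 l t ≤ 1 := by
  rw [mlKernel_one_eq hρ0, ← integral_mlKernel hρ0 hρ0 l ht]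
  have : 0 ≤ ∫ s in (0 : ℝ)..t, mlKernel ρ ρ l s := by
    rw [intervalIntegral.integral_of_le ht]
    exact setIntegral_nonneg measurableSet_Ioc fun s hs => mlKernel_self_nonneg hρ0 hρ1 hl hs.1
  nlinarith

theorem mlKernel_one_antitoneOn (hρ0 : 0 < ρ) (hρ1 : ρ ≤ 1) (hl : 0 < l) :
    AntitoneOn (mlKernel ρ 1 l) (Ici 0) := by
  refine antitoneOn_of_deriv_nonpos (convex_Ici 0) (continuous_mlKernel hρ0 le_rfl l).continuousOn
    (fun x hx => ?_) fun x hx => ?_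
  all_goals rw [interior_Ici] at hx
  · exact (hasDerivAt_mlKernel_one hρ0 l hx).differentiableAt.differentiableWithinAt
  · rw [(hasDerivAt_mlKernel_one hρ0 l hx).deriv]
    have := mlKernel_self_nonneg hρ0 hρ1 hl hx
    nlinarith

theorem mul_mlKernel_add_one_le (hρ0 : 0 < ρ) (hρ1 : ρ ≤ 1) (hl : 0 < l) (ht : 0 ≤ t) :
    l * mlKernel ρ (ρ + 1) l t ≤ 1 := by
  have h1 := mlKernel_one_eq hρ0 l t
  have h2 := mlKernel_one_nonneg hρ0 hρ1 hl ht
  linarith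

/-- Decay of the resolvent kernel: since `x ↦ E_{ρ,ρ}(-x)` decreases,
`l ∫₀ᵗ s^(ρ-1) E_{ρ,ρ}(-l s^ρ) ds ≤ 1` is at least `l E_{ρ,ρ}(-l t^ρ) t^ρ / ρ`. -/
theorem mul_mlKernel_self_le (hρ0 : 0 < ρ) (hρ1 : ρ ≤ 1) (hl : 0 < l) (ht : 0 < t) :
    l * mlKernel ρ ρ l t ≤ ρ / t := by
  have h1 := mul_mlKernel_add_one_le hρ0 hρ1 hl ht.le
  rw [← integral_mlKernel hρ0 hρ0 l ht.le] at h1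
  have hpow : ∫ s in (0 : ℝ)..t, s ^ (ρ - 1) = t ^ ρ / ρ := by
    rw [integral_rpow (Or.inl (by linarith))]
    simp [Real.zero_rpow hρ0.ne']
  have h2 : mittagLeffler ρ ρ (-l * t ^ ρ) * (t ^ ρ / ρ) ≤ ∫ s in (0 : ℝ)..t, mlKernel ρ ρ l s := by
    rw [← hpow, mul_comm, ← intervalIntegral.integral_mul_const]
    refine intervalIntegral.integral_mono_on_of_le_Ioo ht.le
      ((intervalIntegral.intervalIntegrable_rpow' (by linarith)).mul_const _)
      (intervalIntegrable_mlKernel hρ0 hρ0 l 0 t) fun s hs => ?_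
    refine mul_le_mul_of_nonneg_left ?_ (Real.rpow_nonneg hs.1.le _)
    rw [neg_mul, neg_mul]
    exact mittagLeffler_self_neg_antitone hρ0 hρ1 (mul_pos hl (Real.rpow_pos_of_pos hs.1 _))
      (mul_le_mul_of_nonneg_left (Real.rpow_le_rpow hs.1.le hs.2.le hρ0.le) hl.le)
  have h3 : l * mlKernel ρ ρ l t = l * (mittagLeffler ρ ρ (-l * t ^ ρ) * (t ^ ρ / ρ)) * (ρ / t) := by
    rw [mlKernel, Real.rpow_sub_one ht.ne']
    field_simp
  rw [h3]
  have h4 : l * (mittagLeffler ρ ρ (-l * t ^ ρ) * (t ^ ρ / ρ)) ≤ 1 :=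
    (mul_le_mul_of_nonneg_left h2 hl.le).trans h1
  calc _ ≤ 1 * (ρ / t) := mul_le_mul_of_nonneg_right h4 (by positivity)
    _ = ρ / t := one_mul _

/-- Decay of `E_{ρ,1}(-l t^ρ)`: the solution decreases, so its fractional integral, which is at
most `1 / l`, is at least `y(t) t^ρ / Γ(ρ + 1)`. -/
theorem mul_rpow_mul_mlKernel_one_le (hρ0 : 0 < ρ) (hρ1 : ρ ≤ 1) (hl : 0 < l) (ht : 0 < t) :
    l * mlKernel ρ 1 l t ≤ ρ * Real.Gamma ρ / t ^ ρ := by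
  have h1 := mul_mlKernel_add_one_le hρ0 hρ1 hl ht.le
  have hB := integral_rpow_mul_mlKernel hρ0 hρ0 one_pos l ht
  have hpow : ∫ s in (0 : ℝ)..t, (t - s) ^ (ρ - 1) = t ^ ρ / ρ := by
    rw [intervalIntegral.integral_comp_sub_left (fun x => x ^ (ρ - 1)),
      integral_rpow (Or.inl (by linarith))]
    simp [Real.zero_rpow hρ0.ne']
  have h2 : t ^ ρ / ρ * mlKernel ρ 1 l t ≤ Real.Gamma ρ * mlKernel ρ (ρ + 1) l t := by
    rw [← hB, ← hpow, ← intervalIntegral.integral_mul_const]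
    refine intervalIntegral.integral_mono_on_of_le_Ioo ht.le
      ((intervalIntegrable_sub_rpow hρ0 _ _ _).mul_const _)
      (intervalIntegrable_rpow_mul_mlKernel hρ0 hρ0 one_pos l ht) fun s hs => ?_
    exact mul_le_mul_of_nonneg_left
      (mlKernel_one_antitoneOn hρ0 hρ1 hl hs.1.le ht.le hs.2.le)
      (Real.rpow_nonneg (by linarith [hs.2]) _)
  have hΓ := Real.Gamma_pos_of_pos hρ0
  have htρ := Real.rpow_pos_of_pos ht ρ
  rw [le_div_iff₀ htρ]
  have h3 : l * mlKernel ρ 1 l t * t ^ ρ = ρ * l * (t ^ ρ / ρ * mlKernel ρ 1 l t) := by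
    field_simp
  rw [h3]
  calc ρ * l * (t ^ ρ / ρ * mlKernel ρ 1 l t)
      ≤ ρ * l * (Real.Gamma ρ * mlKernel ρ (ρ + 1) l t) :=
        mul_le_mul_of_nonneg_left h2 (by positivity)
    _ = ρ * Real.Gamma ρ * (l * mlKernel ρ (ρ + 1) l t) := by ring
    _ ≤ ρ * Real.Gamma ρ * 1 := mul_le_mul_of_nonneg_left h1 (by positivity)
    _ = ρ * Real.Gamma ρ := mul_one _

theorem mlKernel_two_nonneg (hρ0 : 0 < ρ) (hρ1 : ρ ≤ 1) (hl : 0 < l) (ht : 0 ≤ t) :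
    0 ≤ mlKernel ρ 2 l t := by
  rw [show (2 : ℝ) = 1 + 1 by norm_num, ← integral_mlKernel hρ0 one_pos l ht]
  exact intervalIntegral.integral_nonneg ht fun s hs => mlKernel_one_nonneg hρ0 hρ1 hl hs.1

theorem exists_mul_mlKernel_two_le (hρ0 : 0 < ρ) (hρ1 : ρ ≤ 1) (ht : 0 < t) :
    ∃ C, 0 ≤ C ∧ ∀ l, 0 < l → l * mlKernel ρ 2 l t ≤ C := by
  rcases hρ1.eq_or_lt with rfl | hρ1'
  · refine ⟨1, zero_le_one, fun l hl => ?_⟩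
    have := mul_mlKernel_add_one_le one_pos le_rfl hl ht.le
    norm_num at this
    exact this
  · have hα : 0 < 1 - ρ := by linarith
    have hΓ := Real.Gamma_pos_of_pos hα
    refine ⟨t ^ (1 - ρ) / (1 - ρ) / Real.Gamma (1 - ρ), by positivity, fun l hl => ?_⟩
    have hB := integral_rpow_mul_mlKernel hρ0 hα (by linarith : 0 < ρ + 1) l ht
    rw [show 1 - ρ + (ρ + 1) = 2 by ring] at hB
    have hpow : ∫ s in (0 : ℝ)..t, (t - s) ^ (1 - ρ - 1) = t ^ (1 - ρ) / (1 - ρ) := by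
      rw [intervalIntegral.integral_comp_sub_left (fun x => x ^ (1 - ρ - 1)),
        integral_rpow (Or.inl (by linarith))]
      rw [sub_self, sub_zero, sub_add_cancel, Real.zero_rpow hα.ne', sub_zero]
    rw [le_div_iff₀ hΓ, mul_assoc, mul_comm _ (Real.Gamma _), ← hB, ← hpow,
      ← intervalIntegral.integral_const_mul]
    refine intervalIntegral.integral_mono_on_of_le_Ioo ht.le
      ((intervalIntegrable_rpow_mul_mlKernel hρ0 hα (by linarith) l ht).const_mul _)
      (intervalIntegrable_sub_rpow hα _ _ _) fun s hs => ?_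
    have h1 := mul_mlKernel_add_one_le hρ0 hρ1 hl hs.1.le
    have h2 : 0 ≤ (t - s) ^ (1 - ρ - 1) := Real.rpow_nonneg (by linarith [hs.2]) _
    nlinarith

/-- A nonnegative kernel acts on bounded functions with norm at most its integral. -/
theorem abs_volterra_le {K c : ℝ → ℝ} {M : ℝ} (ht : 0 ≤ t)
    (hK : IntervalIntegrable K volume 0 t) (hK0 : ∀ s ∈ Ioo 0 t, 0 ≤ K s)
    (hc : ∀ s ∈ Icc 0 t, |c s| ≤ M) :
    |volterra K c t| ≤ M * ∫ s in (0 : ℝ)..t, K s := by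
  have hK' : IntervalIntegrable (fun s => K (t - s)) volume 0 t := by
    simpa using intervalIntegrable_sub_mul hK (continuous_const (y := (1 : ℝ)))
  have hsub : ∫ s in (0 : ℝ)..t, K (t - s) = ∫ s in (0 : ℝ)..t, K s := by
    rw [intervalIntegral.integral_comp_sub_left]; simp
  rw [← hsub, ← intervalIntegral.integral_const_mul, ← Real.norm_eq_abs]
  refine intervalIntegral.norm_integral_le_of_norm_le ht ?_ (hK'.const_mul M)
  filter_upwards [compl_mem_ae_iff.2 (measure_singleton t)] with s hst hs
  have h1 := hK0 (t - s) ⟨sub_pos.2 (lt_of_le_of_ne hs.2 hst), by linarith [hs.1]⟩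
  rw [norm_mul, Real.norm_of_nonneg h1, mul_comm]
  exact mul_le_mul_of_nonneg_right (hc s ⟨hs.1.le, hs.2⟩) h1

theorem abs_volterra_mlKernel_self_le {c : ℝ → ℝ} {M : ℝ} (hρ0 : 0 < ρ) (hρ1 : ρ ≤ 1) (hl : 0 < l)
    (ht : 0 ≤ t) (hc : ∀ s ∈ Icc 0 t, |c s| ≤ M) :
    l * |volterra (mlKernel ρ ρ l) c t| ≤ M := by
  have hM : 0 ≤ M := (abs_nonneg _).trans (hc 0 ⟨le_rfl, ht⟩)
  have h1 := abs_volterra_le ht (intervalIntegrable_mlKernel hρ0 hρ0 l 0 t)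
    (fun s hs => mlKernel_self_nonneg hρ0 hρ1 hl hs.1) hc
  rw [integral_mlKernel hρ0 hρ0 l ht] at h1
  have h2 := mul_mlKernel_add_one_le hρ0 hρ1 hl ht
  calc l * |volterra (mlKernel ρ ρ l) c t| ≤ l * (M * mlKernel ρ (ρ + 1) l t) :=
        mul_le_mul_of_nonneg_left h1 hl.le
    _ = M * (l * mlKernel ρ (ρ + 1) l t) := by ring
    _ ≤ M * 1 := mul_le_mul_of_nonneg_left h2 hM
    _ = M := mul_one M

/-- `l p(T)` tends to `∫₀ᵀ g` as `l → ∞`, with rate `1 / l`. -/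
theorem abs_mul_pCoeff_sub_le {T M C : ℝ} (hρ0 : 0 < ρ) (hρ1 : ρ ≤ 1) (hl : 0 < l) (hT : 0 ≤ T)
    {g : ℝ → ℝ} (hg : Continuous g) (hM : ∀ s ∈ Icc 0 T, |g s| ≤ M)
    (hC : l * mlKernel ρ 2 l T ≤ C) :
    |l * pCoeff ρ l g T - ∫ s in (0 : ℝ)..T, g s| ≤ M * C / l := by
  have hM0 : 0 ≤ M := (abs_nonneg _).trans (hM 0 ⟨le_rfl, hT⟩)
  have hy := continuous_mlKernel hρ0 le_rfl l
  have heq : l * pCoeff ρ l g T - ∫ s in (0 : ℝ)..T, g s = -volterra (mlKernel ρ 1 l) g T := by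
    rw [pCoeff_eq_volterra, volterra, volterra, ← intervalIntegral.integral_const_mul,
      ← intervalIntegral.integral_sub, ← intervalIntegral.integral_neg]
    · refine intervalIntegral.integral_congr fun s _ => ?_
      rw [mlKernel_one_eq hρ0]
      ring
    · have := continuous_mlKernel hρ0 (by linarith : 1 ≤ ρ + 1) l
      exact Continuous.intervalIntegrable (by fun_prop) _ _
    · exact hg.intervalIntegrable _ _
  rw [heq, abs_neg, le_div_iff₀ hl]
  have h1 := abs_volterra_le hT (hy.intervalIntegrable 0 T)
    (fun s hs => mlKernel_one_nonneg hρ0 hρ1 hl hs.1.le) hM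
  rw [integral_mlKernel hρ0 one_pos l hT, one_add_one_eq_two] at h1
  calc _ ≤ M * mlKernel ρ 2 l T * l := mul_le_mul_of_nonneg_right h1 hl.le
    _ = M * (l * mlKernel ρ 2 l T) := by ring
    _ ≤ M * C := mul_le_mul_of_nonneg_left hC hM0

end Kernel

/-! ### Diagonal operators in a Hilbert basis -/

section Diagonal

variable {𝕜 H : Type*} [RCLike 𝕜] [NormedAddCommGroup H] [InnerProductSpace 𝕜 H]

theorem HilbertBasis.ext_inner (v : HilbertBasis ℕ 𝕜 H) {x y : H}
    (h : ∀ k, inner 𝕜 (v k) x = inner 𝕜 (v k) y) : x = y := by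
  apply v.repr.injective
  ext k
  rw [v.repr_apply_apply, v.repr_apply_apply, h]

theorem HilbertBasis.hasSum_inner_smul (v : HilbertBasis ℕ 𝕜 H) (x : H) :
    HasSum (fun k => inner 𝕜 (v k) x • v k) x := by
  simpa only [v.repr_apply_apply] using v.hasSum_repr x

theorem HilbertBasis.hasSum_norm_inner_sq (v : HilbertBasis ℕ 𝕜 H) (x : H) :
    HasSum (fun k => ‖(inner 𝕜 (v k) x : 𝕜)‖ ^ 2) (‖x‖ ^ 2) := by
  have h := lp.hasSum_norm (p := 2) (by norm_num) (v.repr x)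
  simpa [v.repr_apply_apply] using h

/-- A square-summable sequence is the sequence of coordinates of a vector. -/
theorem HilbertBasis.exists_inner_eq (v : HilbertBasis ℕ 𝕜 H) {a : ℕ → 𝕜}
    (ha : Summable fun k => ‖a k‖ ^ 2) : ∃ x : H, ∀ k, inner 𝕜 (v k) x = a k := by
  have hmem : Memℓp a 2 := memℓp_gen (by simpa using ha)
  refine ⟨v.repr.symm ⟨a, hmem⟩, fun k => ?_⟩
  rw [← v.repr_apply_apply, LinearIsometryEquiv.apply_symm_apply]

theorem HilbertBasis.summable_mul_inner_sq (v : HilbertBasis ℕ 𝕜 H) {m : ℕ → ℝ} {C : ℝ}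
    (hm : ∀ k, |m k| ≤ C) (x : H) :
    Summable fun k => ‖(m k : 𝕜) * inner 𝕜 (v k) x‖ ^ 2 := by
  refine Summable.of_nonneg_of_le (fun k => by positivity) (fun k => ?_)
    ((v.hasSum_norm_inner_sq x).summable.mul_left (C ^ 2))
  rw [norm_mul, RCLike.norm_ofReal, mul_pow]
  exact mul_le_mul_of_nonneg_right (pow_le_pow_left₀ (abs_nonneg _) (hm k) 2) (by positivity)

/-- The diagonal operator `x ↦ ∑ m_k (x, v_k) v_k` with real multipliers `m_k`. The series
converges when `m` is bounded; otherwise the value may be the junk value of `tsum`. -/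
noncomputable def diagMul (v : HilbertBasis ℕ 𝕜 H) (m : ℕ → ℝ) (x : H) : H :=
  ∑' k, ((m k : 𝕜) * inner 𝕜 (v k) x) • v k

theorem inner_diagMul (v : HilbertBasis ℕ 𝕜 H) {m : ℕ → ℝ} {C : ℝ}
    (hm : ∀ k, |m k| ≤ C) (x : H) (k : ℕ) :
    inner 𝕜 (v k) (diagMul v m x) = (m k : 𝕜) * inner 𝕜 (v k) x := by
  obtain ⟨y, hy⟩ := v.exists_inner_eq (v.summable_mul_inner_sq hm x)
  have : diagMul v m x = y := by
    have := (v.hasSum_inner_smul y).tsum_eq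
    simp only [hy] at this
    exact this
  rw [this, hy]

/-- Diagonal operators with uniformly bounded multipliers converge strongly when the multipliers
converge one by one. -/
theorem tendsto_diagMul (v : HilbertBasis ℕ 𝕜 H) {ι : Type*} {F : Filter ι} {m : ι → ℕ → ℝ}
    {m₀ : ℕ → ℝ} {C : ℝ} (hlim : ∀ k, Tendsto (fun i => m i k) F (𝓝 (m₀ k)))
    (hm : ∀ᶠ i in F, ∀ k, |m i k| ≤ C) (hm₀ : ∀ k, |m₀ k| ≤ C) (x : H) :
    Tendsto (fun i => diagMul v (m i) x) F (𝓝 (diagMul v m₀ x)) := by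
  rw [tendsto_iff_norm_sub_tendsto_zero]
  have hsq : Tendsto (fun i => ∑' k, ‖((m i k - m₀ k : ℝ) : 𝕜) * inner 𝕜 (v k) x‖ ^ 2) F
      (𝓝 (∑' _ : ℕ, (0 : ℝ))) := by
    refine tendsto_tsum_of_dominated_convergence
      ((v.hasSum_norm_inner_sq x).summable.mul_left ((C + C) ^ 2)) (fun k => ?_) ?_
    · have h1 : Tendsto (fun i => m i k - m₀ k) F (𝓝 0) := by
        simpa using (hlim k).sub_const (m₀ k)
      have h2 : Continuous fun r : ℝ => ‖(r : 𝕜) * inner 𝕜 (v k) x‖ ^ 2 := by fun_prop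
      have h3 := (h2.tendsto 0).comp h1
      simp only [map_zero, zero_mul, norm_zero, ne_eq, OfNat.ofNat_ne_zero, not_false_eq_true,
        zero_pow] at h3
      exact h3
    · filter_upwards [hm] with i hi k
      rw [norm_mul, RCLike.norm_ofReal, mul_pow, Real.norm_of_nonneg (by positivity)]
      refine mul_le_mul_of_nonneg_right (pow_le_pow_left₀ (abs_nonneg _) ?_ 2) (by positivity)
      exact (abs_sub _ _).trans (add_le_add (hi k) (hm₀ k))
  rw [tsum_zero] at hsq
  have hsq' : Tendsto (fun i => ‖diagMul v (m i) x - diagMul v m₀ x‖ ^ 2) F (𝓝 0) := by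
    refine hsq.congr' ?_
    filter_upwards [hm] with i hi
    rw [← (v.hasSum_norm_inner_sq (diagMul v (m i) x - diagMul v m₀ x)).tsum_eq]
    refine tsum_congr fun k => ?_
    rw [inner_sub_right, inner_diagMul v hi, inner_diagMul v hm₀]
    push_cast
    rw [sub_mul]
  have := hsq'.sqrt
  simpa [Real.sqrt_sq (norm_nonneg _)] using this

/-- The real normed structure on `H` is an independent instance; by continuity it agrees with the
restriction of scalars from `𝕜`. -/
theorem inner_real_smul [NormedSpace ℝ H] (r : ℝ) (x y : H) :
    (inner 𝕜 x (r • y) : 𝕜) = (r : 𝕜) * inner 𝕜 x y := by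
  rw [RCLike.real_smul_eq_coe_smul (K := 𝕜), inner_smul_right]

theorem hasDerivAt_diagMul [NormedSpace ℝ H] (v : HilbertBasis ℕ 𝕜 H) {m m' : ℝ → ℕ → ℝ}
    {C a b t : ℝ} (ht : t ∈ Ioo a b)
    (hd : ∀ k, ∀ s ∈ Ioo a b, HasDerivAt (fun s => m s k) (m' s k) s)
    (hm : ∀ s ∈ Ioo a b, ∀ k, |m s k| ≤ C) (hm' : ∀ s ∈ Ioo a b, ∀ k, |m' s k| ≤ C) (x : H) :
    HasDerivAt (fun s => diagMul v (m s) x) (diagMul v (m' t) x) t := by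
  rw [hasDerivAt_iff_tendsto_slope]
  -- by the mean value theorem the difference quotients of the multipliers are bounded by `C`
  have hslope : ∀ s ∈ Ioo a b, ∀ k, |slope (fun s => m s k) t s| ≤ C := fun s hs k => by
    have hC : 0 ≤ C := (abs_nonneg _).trans (hm t ht k)
    have := (convex_Ioo a b).norm_image_sub_le_of_norm_hasDerivWithin_le (f := fun s => m s k)
      (f' := fun s => m' s k) (fun s hs => (hd k s hs).hasDerivWithinAt)
      (fun s hs => hm' s hs k) ht hs
    rw [slope_def_field, abs_div]
    exact div_le_of_le_mul₀ (abs_nonneg _) hC this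
  have hmem : ∀ᶠ s in 𝓝[≠] t, s ∈ Ioo a b :=
    mem_nhdsWithin_of_mem_nhds (isOpen_Ioo.mem_nhds ht)
  refine (tendsto_diagMul v (m := fun s k => slope (fun s => m s k) t s) (m₀ := m' t) (C := C)
    (fun k => hasDerivAt_iff_tendsto_slope.1 (hd k t ht)) ?_ (hm' t ht) x).congr' ?_
  · filter_upwards [hmem] with s hs using hslope s hs
  · filter_upwards [hmem] with s hs
    refine v.ext_inner fun k => ?_
    rw [inner_diagMul v (hslope s hs), slope_def_field, slope_def_module, inner_real_smul,
      inner_sub_right, inner_diagMul v (hm s hs), inner_diagMul v (hm t ht), ← sub_mul, ← mul_assoc]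
    push_cast
    ring

theorem inner_intervalIntegral [NormedSpace ℝ H] [CompleteSpace H] (x : H) {f : ℝ → H} {a b : ℝ}
    (hf : IntervalIntegrable f volume a b) :
    (inner 𝕜 x (∫ t in a..b, f t) : 𝕜) = ∫ t in a..b, inner 𝕜 x (f t) :=
  (((innerSL 𝕜 x).restrictScalars ℝ).intervalIntegral_comp_comm hf).symm

/-! ### A self-adjoint operator with an eigenbasis -/

theorem inner_eigenvector_graph [CompleteSpace H] {A : H →ₗ.[𝕜] H} (hA : IsSelfAdjoint A) {e : H}
    {l : ℝ} (he : (e, (l : 𝕜) • e) ∈ A.graph) {x z : H} (hx : (x, z) ∈ A.graph) :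
    inner 𝕜 e z = (l : 𝕜) * inner 𝕜 e x := by
  have hfa : A.IsFormalAdjoint A := by
    have := A.adjoint_isFormalAdjoint hA.dense_domain
    rwa [LinearPMap.isSelfAdjoint_def.1 hA] at this
  obtain ⟨x', rfl, rfl⟩ := (LinearPMap.mem_graph_iff A).1 hx
  obtain ⟨e', he1, he2⟩ := (LinearPMap.mem_graph_iff A).1 he
  have := hfa e' x'
  simp only at he1 he2
  rw [he2, he1, inner_smul_left] at this
  rw [← this]
  simp

/-- A self-adjoint operator is closed, so it may be applied termwise to an eigenvector expansion
as soon as the image series converges. -/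
theorem mem_graph_of_inner_eq [CompleteSpace H] {A : H →ₗ.[𝕜] H} (hA : IsSelfAdjoint A)
    (v : HilbertBasis ℕ 𝕜 H) {lam : ℕ → ℝ} (hv : ∀ k, (v k, (lam k : 𝕜) • v k) ∈ A.graph) {x z : H}
    (h : ∀ k, inner 𝕜 (v k) z = (lam k : 𝕜) * inner 𝕜 (v k) x) : (x, z) ∈ A.graph := by
  have hcl : IsClosed (A.graph : Set (H × H)) := hA.isClosed
  have hsum : HasSum (fun k => (inner 𝕜 (v k) x : 𝕜) • (v k, (lam k : 𝕜) • v k)) (x, z) := by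
    refine (v.hasSum_inner_smul x).prodMk ?_
    refine (v.hasSum_inner_smul z).congr_fun fun k => ?_
    simp only [h, smul_smul, mul_comm]
  exact hcl.mem_of_tendsto hsum
    (Eventually.of_forall fun s => A.graph.sum_mem fun k _ => A.graph.smul_mem _ (hv k))

end Diagonal

/-! ### Time-dependent diagonal operators -/

section DiagonalTime

variable {𝕜 H : Type*} [RCLike 𝕜] [NormedAddCommGroup H] [InnerProductSpace 𝕜 H]

theorem continuousOn_diagMul (v : HilbertBasis ℕ 𝕜 H) {m : ℝ → ℕ → ℝ} {C : ℝ} {S : Set ℝ}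
    (hc : ∀ k, ContinuousOn (fun s => m s k) S) (hm : ∀ s ∈ S, ∀ k, |m s k| ≤ C) (x : H) :
    ContinuousOn (fun s => diagMul v (m s) x) S := fun t ht =>
  tendsto_diagMul v (fun k => hc k t ht)
    (eventually_nhdsWithin_of_forall fun s hs k => hm s hs k) (hm t ht) x

theorem integral_ofReal_mul (f : ℝ → ℝ) (a b : ℝ) (c : 𝕜) :
    ∫ s in a..b, ((f s : ℝ) : 𝕜) * c = ((∫ s in a..b, f s : ℝ) : 𝕜) * c := by
  rw [intervalIntegral.integral_mul_const, intervalIntegral, intervalIntegral, integral_ofReal,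
    integral_ofReal, RCLike.ofReal_sub]

theorem continuousOn_Ioc_of_forall_Icc {E : Type*} [TopologicalSpace E] {f : ℝ → E} {T : ℝ}
    (h : ∀ ε, 0 < ε → ContinuousOn f (Icc ε T)) : ContinuousOn f (Ioc 0 T) := by
  intro t ht
  refine (h (t / 2) (by linarith [ht.1]) t ⟨by linarith [ht.1], ht.2⟩).mono_of_mem_nhdsWithin ?_
  filter_upwards [self_mem_nhdsWithin, mem_nhdsWithin_of_mem_nhds
    (Ioi_mem_nhds (show t / 2 < t by linarith [ht.1]))] with s hs hs'
  exact ⟨le_of_lt hs', hs.2⟩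

theorem abs_integral_le_of_dominated {F N : ℝ → ℝ} {ε t : ℝ} (hε : 0 ≤ ε) (hεt : ε ≤ t)
    (hN : IntervalIntegrable N volume 0 t) (hFN : ∀ s ∈ Ioo 0 t, |F s| ≤ N s) :
    |∫ s in ε..t, F s| ≤ ∫ s in (0 : ℝ)..t, N s := by
  have h0t := hε.trans hεt
  have hsub : uIcc ε t ⊆ uIcc 0 t := by
    rw [uIcc_of_le hεt, uIcc_of_le h0t]; exact Icc_subset_Icc_left hε
  have hsub' : uIcc 0 ε ⊆ uIcc 0 t := by
    rw [uIcc_of_le hε, uIcc_of_le h0t]; exact Icc_subset_Icc_right hεt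
  have h1 : |∫ s in ε..t, F s| ≤ ∫ s in ε..t, N s := by
    rw [← Real.norm_eq_abs]
    refine intervalIntegral.norm_integral_le_of_norm_le hεt ?_ (hN.mono_set hsub)
    filter_upwards [compl_mem_ae_iff.2 (measure_singleton t)] with s hst hs
    exact hFN s ⟨hε.trans_lt hs.1, lt_of_le_of_ne hs.2 hst⟩
  have h2 : 0 ≤ ∫ s in (0 : ℝ)..ε, N s := by
    rw [intervalIntegral.integral_of_le hε, integral_Ioc_eq_integral_Ioo]
    exact setIntegral_nonneg measurableSet_Ioo fun s hs =>
      (abs_nonneg _).trans (hFN s ⟨hs.1, hs.2.trans_le hεt⟩)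
  rw [← intervalIntegral.integral_add_adjacent_intervals (hN.mono_set hsub') (hN.mono_set hsub)]
  linarith

/-- The Caputo derivative acts on the multipliers of a time-dependent diagonal operator. The
truncated integrals are again diagonal operators, and the domination by `N k` bounds their
multipliers uniformly, so that the improper integral converges. -/
theorem hasCaputoDerivAt_diagMul [NormedSpace ℝ H] [CompleteSpace H] (v : HilbertBasis ℕ 𝕜 H)
    {ρ T t C₀ C₁ C₂ : ℝ} (hρ1 : ρ < 1) (ht : 0 < t)
    {m m' : ℝ → ℕ → ℝ} {w : ℕ → ℝ} {N : ℕ → ℝ → ℝ}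
    (hd : ∀ k, ∀ s ∈ Ioc 0 t, HasDerivAt (fun s => m s k) (m' s k) s)
    (hm : ∀ s ∈ Ioc 0 t, ∀ k, |m s k| ≤ C₀)
    (hm' : ∀ s ∈ Ioc 0 t, ∀ k, |m' s k| ≤ C₁ / s)
    (hc : ∀ k, ContinuousOn (fun s => m' s k) (Ioc 0 t))
    (hi : ∀ k, IntervalIntegrable (fun s => (t - s) ^ (-ρ) * m' s k) volume 0 t)
    (hN : ∀ k, IntervalIntegrable (N k) volume 0 t)
    (hmN : ∀ k, ∀ s ∈ Ioo 0 t, |(t - s) ^ (-ρ) * m' s k| ≤ N k s)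
    (hNC : ∀ k, ∫ s in (0 : ℝ)..t, N k s ≤ C₂)
    (hw : ∀ k, ∫ s in (0 : ℝ)..t, (t - s) ^ (-ρ) * m' s k = Real.Gamma (1 - ρ) * w k) (x : H) :
    HasCaputoDerivAt ρ T (fun s => diagMul v (m s) x) (diagMul v w x) t := by
  have hΓ : 0 < Real.Gamma (1 - ρ) := Real.Gamma_pos_of_pos (by linarith)
  have hα : 0 < 1 - ρ := by linarith
  have hC₁ : 0 ≤ C₁ := by
    have := (abs_nonneg _).trans (hm' t ⟨ht, le_rfl⟩ 0)
    by_contra! h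
    exact absurd this (not_le.2 (div_neg_of_neg_of_pos h ht))
  have hloc : ∀ ε, 0 < ε → ∀ s ∈ Icc ε t, ∀ k, |m' s k| ≤ C₁ / ε := fun ε hε s hs k =>
    (hm' s ⟨hε.trans_le hs.1, hs.2⟩ k).trans (div_le_div_of_nonneg_left hC₁ hε hs.1)
  have hint : ∀ ε ∈ Ioo 0 t,
      IntervalIntegrable (fun ξ => (t - ξ) ^ (-ρ) • diagMul v (m' ξ) x) volume ε t := by
    intro ε hε
    have hcont : ContinuousOn (fun ξ => diagMul v (m' ξ) x) (Icc ε t) :=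
      continuousOn_diagMul v
        (fun k => (hc k).mono fun s hs => ⟨hε.1.trans_le hs.1, hs.2⟩) (hloc ε hε.1) x
    have h1 := intervalIntegrable_sub_rpow hα t ε t
    rw [show 1 - ρ - 1 = -ρ by ring] at h1
    refine h1.smul_continuousOn ?_
    rwa [uIcc_of_le hε.2.le]
  have hbound : ∀ ε ∈ Icc 0 t, ∀ k, |∫ s in ε..t, (t - s) ^ (-ρ) * m' s k| ≤ C₂ := fun ε hε k =>
    (abs_integral_le_of_dominated hε.1 hε.2 (hN k) (hmN k)).trans (hNC k)
  have hwb : ∀ k, |w k| ≤ C₂ / Real.Gamma (1 - ρ) := fun k => by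
    have := hbound 0 ⟨le_rfl, ht.le⟩ k
    rw [hw, abs_mul, abs_of_pos hΓ] at this
    rw [le_div_iff₀ hΓ]; linarith
  refine hasCaputoDerivAt_of_tendsto hρ1 ht (u' := fun ξ => diagMul v (m' ξ) x)
    (fun ξ hξ => ?_) hint ?_
  · have hmem : ∀ s ∈ Ioo (ξ / 2) t, s ∈ Ioc 0 t := fun s hs =>
      ⟨by linarith [hs.1, hξ.1], hs.2.le⟩
    refine hasDerivAt_diagMul v (m := m) (a := ξ / 2) (b := t) (C := max C₀ (C₁ / (ξ / 2)))
      ⟨by linarith [hξ.1], hξ.2⟩ (fun k s hs => hd k s (hmem s hs))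
      (fun s hs k => (hm s (hmem s hs) k).trans (le_max_left _ _))
      (fun s hs k => (hloc (ξ / 2) (by linarith [hξ.1]) s ⟨hs.1.le, hs.2.le⟩ k).trans
        (le_max_right _ _)) x
  · have hfin : Real.Gamma (1 - ρ) • diagMul v w x
        = diagMul v (fun k => ∫ s in (0 : ℝ)..t, (t - s) ^ (-ρ) * m' s k) x := by
      refine v.ext_inner fun k => ?_
      rw [inner_real_smul, inner_diagMul v hwb, inner_diagMul v (hbound 0 ⟨le_rfl, ht.le⟩), hw]
      push_cast
      ring
    rw [hfin]
    refine (tendsto_diagMul v (m := fun ε k => ∫ s in ε..t, (t - s) ^ (-ρ) * m' s k) (C := C₂)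
      (fun k => tendsto_integral_nhdsGT_zero ht (hi k)) ?_
      (hbound 0 ⟨le_rfl, ht.le⟩) x).congr' ?_
    · filter_upwards [Ioo_mem_nhdsGT ht] with ε hε using hbound ε ⟨hε.1.le, hε.2.le⟩
    · filter_upwards [Ioo_mem_nhdsGT ht] with ε hε
      refine v.ext_inner fun k => ?_
      rw [inner_diagMul v (hbound ε ⟨hε.1.le, hε.2.le⟩), inner_intervalIntegral _ (hint ε hε),
        ← integral_ofReal_mul]
      refine intervalIntegral.integral_congr fun s hs => ?_
      rw [uIcc_of_le hε.2.le] at hs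
      rw [inner_real_smul, inner_diagMul v (hloc ε hε.1 s hs)]
      push_cast
      ring

theorem HasCaputoDerivAt.add [NormedSpace ℝ H] [CompleteSpace H] {ρ T t : ℝ} (hρ1 : ρ ≤ 1)
    {u z : ℝ → H} {w x : H}
    (hu : HasCaputoDerivAt ρ T u w t) (hz : HasCaputoDerivAt ρ T z x t) (ht : 0 < t) :
    HasCaputoDerivAt ρ T (fun s => u s + z s) (w + x) t := by
  have h := hz.clm_apply hρ1 ht (-ContinuousLinearMap.id ℝ H)
  simpa using hu.sub hρ1 h ht

end DiagonalTime

/-! ### Extension of the source factor -/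

/-- A `C¹` function on `[0, T₀]` extends to a `C¹` function on `ℝ`: integrate the constant extension
of its derivative. -/
theorem exists_hasDerivAt_extension {g : ℝ → ℝ} {T₀ : ℝ} (hT₀ : 0 < T₀)
    (hg : ContDiffOn ℝ 1 g (Icc 0 T₀)) :
    ∃ G G' : ℝ → ℝ, (∀ s, HasDerivAt G (G' s) s) ∧ Continuous G' ∧ EqOn G g (Icc 0 T₀) := by
  have hgc : ContinuousOn (derivWithin g (Icc 0 T₀)) (Icc 0 T₀) :=
    hg.continuousOn_derivWithin (uniqueDiffOn_Icc hT₀) le_rfl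
  set G' : ℝ → ℝ := IccExtend hT₀.le ((Icc 0 T₀).domRestrict (derivWithin g (Icc 0 T₀))) with hG'
  have hG'c : Continuous G' := (continuousOn_iff_continuous_domRestrict.1 hgc).Icc_extend'
  have hG'eq : ∀ s ∈ Icc 0 T₀, G' s = derivWithin g (Icc 0 T₀) s := fun s hs => by
    rw [hG', IccExtend_of_mem _ _ hs]; rfl
  refine ⟨fun t => g 0 + ∫ s in (0 : ℝ)..t, G' s, G', fun s => ?_, hG'c, fun t ht => ?_⟩
  · exact (intervalIntegral.integral_hasDerivAt_right (hG'c.intervalIntegrable _ _)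
      (hG'c.stronglyMeasurableAtFilter _ _) hG'c.continuousAt).const_add _
  · have := intervalIntegral.integral_eq_sub_of_hasDerivAt_of_le ht.1 (f := g) (f' := G')
      (hg.continuousOn.mono (Icc_subset_Icc_right ht.2)) (fun x hx => ?_)
      (hG'c.intervalIntegrable _ _)
    · simp only [this]; ring
    · have hx' : x ∈ Icc 0 T₀ := ⟨hx.1.le, hx.2.le.trans ht.2⟩
      rw [hG'eq x hx']
      exact ((hg.differentiableOn one_ne_zero) x hx').hasDerivWithinAt.hasDerivAt
        (Icc_mem_nhds hx.1 (hx.2.trans_le ht.2))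

/-! ### Bounds that are uniform in the eigenvalue -/

theorem abs_le_div_of_mul_abs_le {l₀ l a M : ℝ} (hl₀ : 0 < l₀) (hl : l₀ ≤ l) (h : l * |a| ≤ M) :
    |a| ≤ M / l₀ := by
  rw [le_div_iff₀ hl₀, mul_comm]
  exact (mul_le_mul_of_nonneg_right hl (abs_nonneg a)).trans h

theorem abs_mlKernel_one_le {ρ l t : ℝ} (hρ0 : 0 < ρ) (hρ1 : ρ ≤ 1) (hl : 0 < l) (ht : 0 ≤ t) :
    |mlKernel ρ 1 l t| ≤ 1 := by
  rw [abs_of_nonneg (mlKernel_one_nonneg hρ0 hρ1 hl ht)]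
  exact mlKernel_one_le_one hρ0 hρ1 hl ht

theorem abs_mul_mlKernel_self_le {ρ l t : ℝ} (hρ0 : 0 < ρ) (hρ1 : ρ ≤ 1) (hl : 0 < l)
    (ht : 0 < t) : l * |mlKernel ρ ρ l t| ≤ ρ / t := by
  rw [abs_of_nonneg (mlKernel_self_nonneg hρ0 hρ1 hl ht)]
  exact mul_mlKernel_self_le hρ0 hρ1 hl ht

theorem mul_abs_deriv_sourceResponse_le {ρ l t M : ℝ} {g g' : ℝ → ℝ} (hρ0 : 0 < ρ) (hρ1 : ρ ≤ 1)
    (hl : 0 < l) (ht : 0 < t) (hM : |g 0| ≤ M) (hM' : ∀ s ∈ Icc 0 t, |g' s| ≤ M) :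
    l * |g 0 * mlKernel ρ ρ l t + volterra (mlKernel ρ ρ l) g' t| ≤ M * (ρ + t) / t := by
  have hM0 : 0 ≤ M := (abs_nonneg _).trans hM
  have h1 := abs_mul_mlKernel_self_le hρ0 hρ1 hl ht
  have h2 := abs_volterra_mlKernel_self_le hρ0 hρ1 hl ht.le hM'
  calc l * |g 0 * mlKernel ρ ρ l t + volterra (mlKernel ρ ρ l) g' t|
      ≤ l * (|g 0| * |mlKernel ρ ρ l t| + |volterra (mlKernel ρ ρ l) g' t|) := by
        rw [← abs_mul]
        exact mul_le_mul_of_nonneg_left (abs_add_le _ _) hl.le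
    _ = |g 0| * (l * |mlKernel ρ ρ l t|) + l * |volterra (mlKernel ρ ρ l) g' t| := by ring
    _ ≤ M * (ρ / t) + M :=
        add_le_add (mul_le_mul hM h1 (mul_nonneg hl.le (abs_nonneg _)) hM0) h2
    _ = M * (ρ + t) / t := by field_simp

theorem exists_common_bound {g g' : ℝ → ℝ} (hg : Continuous g) (hg' : Continuous g') (R : ℝ) :
    ∃ M, 0 ≤ M ∧ (∀ s ∈ Icc 0 R, |g s| ≤ M) ∧ ∀ s ∈ Icc 0 R, |g' s| ≤ M := by
  obtain ⟨M₁, h₁⟩ := (isCompact_Icc (a := (0 : ℝ)) (b := R)).exists_bound_of_continuousOn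
    hg.continuousOn
  obtain ⟨M₂, h₂⟩ := (isCompact_Icc (a := (0 : ℝ)) (b := R)).exists_bound_of_continuousOn
    hg'.continuousOn
  exact ⟨max 0 (max M₁ M₂), le_max_left _ _,
    fun s hs => (h₁ s hs).trans ((le_max_left _ _).trans (le_max_right _ _)),
    fun s hs => (h₂ s hs).trans ((le_max_right _ _).trans (le_max_right _ _))⟩

theorem continuousOn_deriv_sourceResponse {ρ : ℝ} (hρ0 : 0 < ρ) (l : ℝ) (g : ℝ → ℝ) {g' : ℝ → ℝ}
    (hg' : Continuous g') {T : ℝ} (hT : 0 ≤ T) :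
    ContinuousOn (fun s => g 0 * mlKernel ρ ρ l s + volterra (mlKernel ρ ρ l) g' s) (Ioc 0 T) :=
  (((continuousOn_mlKernel hρ0 hρ0 l).mono Ioc_subset_Ioi_self).const_mul _).add
    ((continuousOn_volterra hT (intervalIntegrable_mlKernel hρ0 hρ0 l 0 T) hg').mono
      Ioc_subset_Icc_self)

/-! ### Caputo derivatives of the solution operators -/

section SolutionOperators

variable {𝕜 H : Type*} [RCLike 𝕜] [NormedAddCommGroup H] [InnerProductSpace 𝕜 H]
  [NormedSpace ℝ H] [CompleteSpace H]

theorem hasCaputoDerivAt_diagMul_mlKernel (v : HilbertBasis ℕ 𝕜 H) {lam : ℕ → ℝ}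
    (hlam : ∀ k, 0 < lam k) {ρ T t : ℝ} (hρ0 : 0 < ρ) (hρ1 : ρ ≤ 1) (ht : 0 < t) (x : H) :
    HasCaputoDerivAt ρ T (fun s => diagMul v (fun k => mlKernel ρ 1 (lam k) s) x)
      (diagMul v (fun k => -lam k * mlKernel ρ 1 (lam k) t) x) t := by
  have hb' : ∀ s, 0 < s → ∀ k, |-lam k * mlKernel ρ ρ (lam k) s| ≤ ρ / s := fun s hs k => by
    rw [abs_mul, abs_neg, abs_of_pos (hlam k)]
    exact abs_mul_mlKernel_self_le hρ0 hρ1 (hlam k) hs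
  rcases hρ1.eq_or_lt with rfl | hρ1'
  · rw [hasCaputoDerivAt_one]
    refine (hasDerivAt_diagMul v (a := t / 2) (b := t + 1) (C := max 1 (1 / (t / 2)))
      (m := fun s k => mlKernel 1 1 (lam k) s) (m' := fun s k => -lam k * mlKernel 1 1 (lam k) s)
      ⟨by linarith, by linarith⟩
      (fun k s hs => hasDerivAt_mlKernel_one one_pos _ (by linarith [hs.1]))
      (fun s hs k => ?_) (fun s hs k => ?_) x).hasDerivWithinAt
    · exact (abs_mlKernel_one_le one_pos le_rfl (hlam k) (by linarith [hs.1])).trans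
        (le_max_left _ _)
    · refine ((hb' s (by linarith [hs.1]) k).trans ?_).trans (le_max_right _ _)
      exact div_le_div_of_nonneg_left zero_le_one (by linarith) hs.1.le
  · have hα : 0 < 1 - ρ := by linarith
    have hΓ := Real.Gamma_pos_of_pos hα
    have hi : ∀ k, IntervalIntegrable (fun s => (t - s) ^ (-ρ) * mlKernel ρ ρ (lam k) s)
        volume 0 t := fun k => by
      have := intervalIntegrable_rpow_mul_mlKernel hρ0 hα hρ0 (lam k) ht
      rwa [show 1 - ρ - 1 = -ρ by ring] at this
    have hI : ∀ k, ∫ s in (0 : ℝ)..t, (t - s) ^ (-ρ) * mlKernel ρ ρ (lam k) s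
        = Real.Gamma (1 - ρ) * mlKernel ρ 1 (lam k) t := fun k => by
      have := integral_rpow_mul_mlKernel hρ0 hα hρ0 (lam k) ht
      rwa [show 1 - ρ - 1 = -ρ by ring, sub_add_cancel] at this
    have hcomm : ∀ (c : ℝ) k, (fun s => (t - s) ^ (-ρ) * (c * mlKernel ρ ρ (lam k) s))
        = fun s => c * ((t - s) ^ (-ρ) * mlKernel ρ ρ (lam k) s) := fun c k => by
      funext s; ring
    refine hasCaputoDerivAt_diagMul v hρ1' ht (C₀ := 1) (C₁ := ρ)
      (C₂ := Real.Gamma (1 - ρ) * (ρ * Real.Gamma ρ / t ^ ρ))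
      (m := fun s k => mlKernel ρ 1 (lam k) s)
      (m' := fun s k => -lam k * mlKernel ρ ρ (lam k) s)
      (N := fun k s => (t - s) ^ (-ρ) * (lam k * mlKernel ρ ρ (lam k) s))
      (fun k s hs => hasDerivAt_mlKernel_one hρ0 _ hs.1)
      (fun s hs k => abs_mlKernel_one_le hρ0 hρ1 (hlam k) hs.1.le)
      (fun s hs k => hb' s hs.1 k)
      (fun k => ((continuousOn_mlKernel hρ0 hρ0 _).mono Ioc_subset_Ioi_self).const_mul _)
      (fun k => ?_) (fun k => ?_) (fun k s hs => ?_) (fun k => ?_) (fun k => ?_) x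
    · rw [hcomm]; exact (hi k).const_mul _
    · rw [hcomm]; exact (hi k).const_mul _
    · rw [abs_mul, abs_mul, abs_neg, abs_of_pos (hlam k),
        abs_of_nonneg (Real.rpow_nonneg (by linarith [hs.2]) _),
        abs_of_nonneg (mlKernel_self_nonneg hρ0 hρ1 (hlam k) hs.1)]
    · rw [hcomm, intervalIntegral.integral_const_mul, hI]
      have := mul_rpow_mul_mlKernel_one_le hρ0 hρ1 (hlam k) ht
      calc _ = Real.Gamma (1 - ρ) * (lam k * mlKernel ρ 1 (lam k) t) := by ring
        _ ≤ _ := mul_le_mul_of_nonneg_left this hΓ.le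
    · rw [hcomm, intervalIntegral.integral_const_mul, hI]
      ring

theorem hasCaputoDerivAt_diagMul_sourceResponse (v : HilbertBasis ℕ 𝕜 H) {lam : ℕ → ℝ} {l₀ : ℝ}
    (hl₀ : 0 < l₀) (hlam : ∀ k, l₀ ≤ lam k) {ρ T t : ℝ} (hρ0 : 0 < ρ) (hρ1 : ρ ≤ 1) (ht : 0 < t)
    {g g' : ℝ → ℝ} (hg : ∀ s, HasDerivAt g (g' s) s) (hg' : Continuous g') (x : H) :
    HasCaputoDerivAt ρ T (fun s => diagMul v (fun k => sourceResponse ρ (lam k) g s) x)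
      (diagMul v (fun k => g t - lam k * sourceResponse ρ (lam k) g t) x) t := by
  have hpos : ∀ k, 0 < lam k := fun k => hl₀.trans_le (hlam k)
  have hgc : Continuous g := continuous_iff_continuousAt.2 fun s => (hg s).continuousAt
  obtain ⟨M, hM0, hM, hM'⟩ := exists_common_bound hgc hg' (t + 1)
  have hb : ∀ s ∈ Ioc 0 (t + 1), ∀ k, |sourceResponse ρ (lam k) g s| ≤ M / l₀ := fun s hs k =>
    abs_le_div_of_mul_abs_le hl₀ (hlam k) (abs_volterra_mlKernel_self_le hρ0 hρ1 (hpos k) hs.1.le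
      fun r hr => hM r ⟨hr.1, hr.2.trans hs.2⟩)
  have hb' : ∀ s ∈ Ioc 0 (t + 1), ∀ k,
      |g 0 * mlKernel ρ ρ (lam k) s + volterra (mlKernel ρ ρ (lam k)) g' s|
        ≤ M * (ρ + (t + 1)) / l₀ / s := fun s hs k => by
    have h1 := abs_le_div_of_mul_abs_le hl₀ (hlam k)
      (mul_abs_deriv_sourceResponse_le (g := g) (M := M) hρ0 hρ1 (hpos k) hs.1
        (hM 0 ⟨le_rfl, by linarith⟩) fun r hr => hM' r ⟨hr.1, hr.2.trans hs.2⟩)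
    refine h1.trans ?_
    rw [div_right_comm]
    refine div_le_div_of_nonneg_right (div_le_div_of_nonneg_right ?_ hl₀.le) hs.1.le
    exact mul_le_mul_of_nonneg_left (by linarith [hs.2]) hM0
  rcases hρ1.eq_or_lt with rfl | hρ1'
  · rw [hasCaputoDerivAt_one]
    have hfun : (fun k => g t - lam k * sourceResponse 1 (lam k) g t) =
        fun k => g 0 * mlKernel 1 1 (lam k) t + volterra (mlKernel 1 1 (lam k)) g' t :=
      funext fun k => (mlKernel_mul_add_volterra one_pos _ hg hg' ht.le).symm
    rw [hfun]
    set D := M * (1 + (t + 1)) / l₀ with hD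
    have hD0 : 0 ≤ D := by positivity
    refine (hasDerivAt_diagMul v (a := t / 2) (b := t + 1) (C := max (M / l₀) (D / (t / 2)))
      (m := fun s k => sourceResponse 1 (lam k) g s)
      (m' := fun s k => g 0 * mlKernel 1 1 (lam k) s + volterra (mlKernel 1 1 (lam k)) g' s)
      ⟨by linarith, by linarith⟩
      (fun k s hs => hasDerivAt_sourceResponse one_pos _ hg hg' (by linarith [hs.1]))
      (fun s hs k => ?_) (fun s hs k => ?_) x).hasDerivWithinAt
    · exact (hb s ⟨by linarith [hs.1], hs.2.le⟩ k).trans (le_max_left _ _)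
    · refine ((hb' s ⟨by linarith [hs.1], hs.2.le⟩ k).trans ?_).trans (le_max_right _ _)
      exact div_le_div_of_nonneg_left hD0 (by linarith) hs.1.le
  · have hα : 0 < 1 - ρ := by linarith
    have hΓ := Real.Gamma_pos_of_pos hα
    have hi : ∀ k, IntervalIntegrable (fun s => (t - s) ^ (-ρ) * mlKernel ρ ρ (lam k) s)
        volume 0 t := fun k => by
      have := intervalIntegrable_rpow_mul_mlKernel hρ0 hα hρ0 (lam k) ht
      rwa [show 1 - ρ - 1 = -ρ by ring] at this
    have hI : ∀ k, ∫ s in (0 : ℝ)..t, (t - s) ^ (-ρ) * mlKernel ρ ρ (lam k) s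
        = Real.Gamma (1 - ρ) * mlKernel ρ 1 (lam k) t := fun k => by
      have := integral_rpow_mul_mlKernel hρ0 hα hρ0 (lam k) ht
      rwa [show 1 - ρ - 1 = -ρ by ring, sub_add_cancel] at this
    have hw : IntervalIntegrable (fun s : ℝ => (t - s) ^ (-ρ)) volume 0 t := by
      have := intervalIntegrable_sub_rpow hα t 0 t
      rwa [show 1 - ρ - 1 = -ρ by ring] at this
    have hsub : ∀ s ∈ Ioc 0 t, s ∈ Ioc 0 (t + 1) := fun s hs => ⟨hs.1, by linarith [hs.2]⟩
    refine hasCaputoDerivAt_diagMul v hρ1' ht (C₀ := M / l₀) (C₁ := M * (ρ + (t + 1)) / l₀)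
      (C₂ := M * Real.Gamma (1 - ρ) + M / l₀ * ∫ s in (0 : ℝ)..t, (t - s) ^ (-ρ))
      (m := fun s k => sourceResponse ρ (lam k) g s)
      (m' := fun s k => g 0 * mlKernel ρ ρ (lam k) s + volterra (mlKernel ρ ρ (lam k)) g' s)
      (N := fun k s => M * ((t - s) ^ (-ρ) * mlKernel ρ ρ (lam k) s)
        + M / l₀ * (t - s) ^ (-ρ))
      (fun k s hs => hasDerivAt_sourceResponse hρ0 _ hg hg' hs.1)
      (fun s hs k => hb s (hsub s hs) k) (fun s hs k => hb' s (hsub s hs) k)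
      (fun k => continuousOn_deriv_sourceResponse hρ0 _ g hg' ht.le)
      (fun k => (integral_rpow_mul_deriv_sourceResponse hρ0 hρ1' _ hg hg' ht).1)
      (fun k => ((hi k).const_mul _).add (hw.const_mul _)) (fun k s hs => ?_) (fun k => ?_)
      (fun k => (integral_rpow_mul_deriv_sourceResponse hρ0 hρ1' _ hg hg' ht).2) x
    · have h1 := Real.rpow_nonneg (by linarith [hs.2] : 0 ≤ t - s) (-ρ)
      have h2 := mlKernel_self_nonneg hρ0 hρ1 (hpos k) hs.1
      have h3 : |volterra (mlKernel ρ ρ (lam k)) g' s| ≤ M / l₀ :=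
        abs_le_div_of_mul_abs_le hl₀ (hlam k)
          (abs_volterra_mlKernel_self_le hρ0 hρ1 (hpos k) hs.1.le
            fun r hr => hM' r ⟨hr.1, by linarith [hr.2, hs.2]⟩)
      have h4 : |g 0 * mlKernel ρ ρ (lam k) s| ≤ M * mlKernel ρ ρ (lam k) s := by
        rw [abs_mul, abs_of_nonneg h2]
        exact mul_le_mul_of_nonneg_right (hM 0 ⟨le_rfl, by linarith⟩) h2
      rw [abs_mul, abs_of_nonneg h1]
      calc _ ≤ (t - s) ^ (-ρ) * (M * mlKernel ρ ρ (lam k) s + M / l₀) :=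
            mul_le_mul_of_nonneg_left ((abs_add_le _ _).trans (add_le_add h4 h3)) h1
        _ = _ := by ring
    · rw [intervalIntegral.integral_add ((hi k).const_mul _) (hw.const_mul _),
        intervalIntegral.integral_const_mul, intervalIntegral.integral_const_mul, hI]
      have h1 := mlKernel_one_le_one hρ0 hρ1 (hpos k) ht.le
      have h2 : M * (Real.Gamma (1 - ρ) * mlKernel ρ 1 (lam k) t) ≤ M * Real.Gamma (1 - ρ) := by
        refine mul_le_mul_of_nonneg_left ?_ hM0
        nlinarith
      linarith

end SolutionOperators

/-! ### Solutions and their Fourier coefficients -/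

theorem mittagLeffler_one_eq_mlKernel (ρ l t : ℝ) :
    mittagLeffler ρ 1 (-l * t ^ ρ) = mlKernel ρ 1 l t := by
  simp [mlKernel]

theorem mul_mittagLeffler_two_eq_mlKernel (ρ l t : ℝ) :
    t * mittagLeffler ρ 2 (-l * t ^ ρ) = mlKernel ρ 2 l t := by
  rw [mlKernel, show (2 : ℝ) - 1 = 1 by norm_num, Real.rpow_one]

section Solutions

variable {𝕜 H : Type*} [RCLike 𝕜] [NormedAddCommGroup H] [InnerProductSpace 𝕜 H]

/-- The vector `∑ [φ_k E_{ρ,1}(-λ_k t^ρ) + f_k q_k(t)] v_k`. -/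
noncomputable def seriesSolution (v : HilbertBasis ℕ 𝕜 H) (lam : ℕ → ℝ) (ρ : ℝ) (g : ℝ → ℝ) (φ f : H) (t : ℝ) :
    H :=
  diagMul v (fun k => mlKernel ρ 1 (lam k) t) φ +
    diagMul v (fun k => sourceResponse ρ (lam k) g t) f

/-- The coordinates prescribed for a solution by the scalar equations. -/
noncomputable def coordSolution (v : HilbertBasis ℕ 𝕜 H) (lam : ℕ → ℝ) (ρ : ℝ) (g : ℝ → ℝ) (φ f : H) (t : ℝ)
    (k : ℕ) : 𝕜 :=
  (mlKernel ρ 1 (lam k) t : 𝕜) * inner 𝕜 (v k) φ +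
    (sourceResponse ρ (lam k) g t : 𝕜) * inner 𝕜 (v k) f

/-- A function with the prescribed coordinates is given by the Fourier series. -/
theorem isGivenBySeries_of_coord (v : HilbertBasis ℕ 𝕜 H) {lam : ℕ → ℝ} {ρ T : ℝ} {g : ℝ → ℝ}
    {φ f : H} {u : ℝ → H} {a : ℕ → 𝕜} (ha : ∀ k, a k = inner 𝕜 (v k) f)
    (hu : ∀ t ∈ Icc 0 T, ∀ k, inner 𝕜 (v k) (u t) = coordSolution v lam ρ g φ f t k) :
    IsGivenBySeries v lam ρ T g φ a u f := by
  refine ⟨by simpa only [ha] using v.hasSum_inner_smul f, fun t ht => ?_⟩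
  refine (v.hasSum_inner_smul (u t)).congr_fun fun k => ?_
  rw [hu t ht, coordSolution, mittagLeffler_one_eq_mlKernel, ha]
  congr 1
  ring

/-- The coordinates of the integral over `[0, T]` of a function with the prescribed coordinates. -/
theorem inner_integral_of_coord [NormedSpace ℝ H] [CompleteSpace H] (v : HilbertBasis ℕ 𝕜 H)
    {lam : ℕ → ℝ} {ρ T : ℝ} (hρ0 : 0 < ρ) (hT : 0 ≤ T) {g : ℝ → ℝ} (hg : Continuous g)
    {φ f : H} {u : ℝ → H} (huc : ContinuousOn u (Icc 0 T))
    (hu : ∀ t ∈ Icc 0 T, ∀ k, inner 𝕜 (v k) (u t) = coordSolution v lam ρ g φ f t k) (k : ℕ) :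
    inner 𝕜 (v k) (∫ t in (0 : ℝ)..T, u t)
      = ((mlKernel ρ 2 (lam k) T : ℝ) : 𝕜) * inner 𝕜 (v k) φ
        + ((pCoeff ρ (lam k) g T : ℝ) : 𝕜) * inner 𝕜 (v k) f := by
  have hi : IntervalIntegrable u volume 0 T := by
    refine ContinuousOn.intervalIntegrable ?_
    rwa [uIcc_of_le hT]
  rw [inner_intervalIntegral _ hi]
  have h1 : ∫ t in (0 : ℝ)..T, inner 𝕜 (v k) (u t)
      = ∫ t in (0 : ℝ)..T, coordSolution v lam ρ g φ f t k := by
    refine intervalIntegral.integral_congr fun t ht => ?_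
    rw [uIcc_of_le hT] at ht
    exact hu t ht k
  have hy : IntervalIntegrable (fun t => ((mlKernel ρ 1 (lam k) t : ℝ) : 𝕜) * inner 𝕜 (v k) φ)
      volume 0 T := by
    have := continuous_mlKernel hρ0 le_rfl (lam k)
    exact Continuous.intervalIntegrable (by fun_prop) _ _
  have hq : IntervalIntegrable
      (fun t => ((sourceResponse ρ (lam k) g t : ℝ) : 𝕜) * inner 𝕜 (v k) f) volume 0 T := by
    refine ContinuousOn.intervalIntegrable ?_
    rw [uIcc_of_le hT]
    exact (RCLike.continuous_ofReal.comp_continuousOn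
      (continuousOn_sourceResponse hρ0 (lam k) hg hT)).mul continuousOn_const
  rw [h1]
  unfold coordSolution
  rw [intervalIntegral.integral_add hy hq, integral_ofReal_mul, integral_ofReal_mul,
    integral_mlKernel hρ0 one_pos _ hT, one_add_one_eq_two,
    integral_sourceResponse hρ0 _ hT hg.continuousOn]

/-- Every solution has the prescribed coordinates: its coordinates solve the scalar Caputo
equations, whose solutions are unique by the comparison principle. -/
theorem IsInverseSolution.inner_eq [NormedSpace ℝ H] [CompleteSpace H] {A : H →ₗ.[𝕜] H}
    (hA : IsSelfAdjoint A) (v : HilbertBasis ℕ 𝕜 H) {lam : ℕ → ℝ}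
    (hv : ∀ k, (v k, (lam k : 𝕜) • v k) ∈ A.graph) (hlam : ∀ k, 0 < lam k) {ρ T : ℝ}
    (hρ0 : 0 < ρ) (hρ1 : ρ ≤ 1) (hT : 0 < T) {g g' : ℝ → ℝ} (hg : ∀ s, HasDerivAt g (g' s) s)
    (hg' : Continuous g') {φ ψ f : H} {u : ℝ → H} (h : IsInverseSolution A ρ T g φ ψ u f) :
    ∀ t ∈ Icc 0 T, ∀ k, inner 𝕜 (v k) (u t) = coordSolution v lam ρ g φ f t k := by
  intro t ht k
  have hgc : Continuous g := continuous_iff_continuousAt.2 fun s => (hg s).continuousAt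
  obtain ⟨w, z, -, -, heq⟩ := h.equation
  have key : ∀ τ : 𝕜 →L[ℝ] ℝ, τ (inner 𝕜 (v k) (u t)) = τ (coordSolution v lam ρ g φ f t k) := by
    -- `τ` stands for the real or the imaginary part
    intro τ
    let L : H →L[ℝ] ℝ := τ.comp ((innerSL 𝕜 (v k)).restrictScalars ℝ)
    have hL : ∀ x, L x = τ (inner 𝕜 (v k) x) := fun _ => rfl
    have hτ : ∀ (r : ℝ) (c : 𝕜), τ ((r : 𝕜) * c) = r * τ c := fun r c => by
      rw [← RCLike.real_smul_eq_coe_mul, map_smul, smul_eq_mul]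
    have huniq := caputo_unique hρ0 hρ1 (hlam k) (T := T) (y := fun s => L (u s))
      (z := fun s => L φ * mlKernel ρ 1 (lam k) s + L f * sourceResponse ρ (lam k) g s)
      (w := fun s => L (w s))
      (x := fun s => L φ * (-lam k * mlKernel ρ 1 (lam k) s)
        + L f * (g s - lam k * sourceResponse ρ (lam k) g s))
      (L.continuous.comp_continuousOn h.continuousOn)
      (((continuous_mlKernel hρ0 le_rfl (lam k)).continuousOn.const_mul _).add
        ((continuousOn_sourceResponse hρ0 (lam k) hgc hT.le).const_mul _))
      (fun s hs => (heq s hs).1.clm_apply hρ1 hs.1 L)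
      (fun s hs => (hasCaputoDerivAt_mlKernel_one hρ0 hρ1 _ hs.1).add_const_mul hρ1
        (hasCaputoDerivAt_sourceResponse hρ0 hρ1 _ hg hg' hs.1) hs.1 _ _)
      (fun s hs => ?_) ?_ ht
    · simp only [hL] at huniq
      rw [huniq, coordSolution, map_add, hτ, hτ]
      ring
    · obtain ⟨-, hgr, he⟩ := heq s hs
      have h1 : L (z s) = lam k * L (u s) := by
        rw [hL, inner_eigenvector_graph hA (hv k) hgr, hτ, hL]
      have h2 : L (w s) + L (z s) = g s * L f := by
        rw [← map_add, he, map_smul, smul_eq_mul]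
      linear_combination h2 - h1
    · simp [h.initial, mlKernel_one_zero hρ0, sourceResponse_zero]
  exact RCLike.ext (key RCLike.reCLM) (key RCLike.imCLM)

theorem fourierResidual_eq (v : HilbertBasis ℕ 𝕜 H) (lam : ℕ → ℝ) (ρ T : ℝ) (φ ψ : H) (k : ℕ) :
    fourierResidual v lam ρ T φ ψ k
      = inner 𝕜 (v k) ψ - ((mlKernel ρ 2 (lam k) T : ℝ) : 𝕜) * inner 𝕜 (v k) φ := by
  rw [fourierResidual, mul_mittagLeffler_two_eq_mlKernel, mul_comm]

/-- The overdetermination condition forces `p_k(T) f_k` to be the Fourier residual. -/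
theorem IsInverseSolution.pCoeff_mul_inner [NormedSpace ℝ H] [CompleteSpace H] {A : H →ₗ.[𝕜] H}
    (hA : IsSelfAdjoint A) (v : HilbertBasis ℕ 𝕜 H) {lam : ℕ → ℝ}
    (hv : ∀ k, (v k, (lam k : 𝕜) • v k) ∈ A.graph) (hlam : ∀ k, 0 < lam k) {ρ T : ℝ}
    (hρ0 : 0 < ρ) (hρ1 : ρ ≤ 1) (hT : 0 < T) {g g' : ℝ → ℝ} (hg : ∀ s, HasDerivAt g (g' s) s)
    (hg' : Continuous g') {φ ψ f : H} {u : ℝ → H} (h : IsInverseSolution A ρ T g φ ψ u f) (k : ℕ) :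
    ((pCoeff ρ (lam k) g T : ℝ) : 𝕜) * inner 𝕜 (v k) f = fourierResidual v lam ρ T φ ψ k := by
  have hgc : Continuous g := continuous_iff_continuousAt.2 fun s => (hg s).continuousAt
  have h1 := inner_integral_of_coord v hρ0 hT.le hgc h.continuousOn
    (h.inner_eq hA v hv hlam hρ0 hρ1 hT hg hg') k
  rw [h.integral] at h1
  rw [fourierResidual_eq, h1]
  ring

/-- Conversely, the series with a source `f` satisfying the coefficient equations is a solution. -/
theorem isInverseSolution_seriesSolution [NormedSpace ℝ H] [CompleteSpace H] {A : H →ₗ.[𝕜] H}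
    (hA : IsSelfAdjoint A) (v : HilbertBasis ℕ 𝕜 H) {lam : ℕ → ℝ} {l₀ : ℝ} (hl₀ : 0 < l₀)
    (hv : ∀ k, (v k, (lam k : 𝕜) • v k) ∈ A.graph) (hlam : ∀ k, l₀ ≤ lam k) {ρ T : ℝ}
    (hρ0 : 0 < ρ) (hρ1 : ρ ≤ 1) (hT : 0 < T) {g g' : ℝ → ℝ} (hg : ∀ s, HasDerivAt g (g' s) s)
    (hg' : Continuous g') {φ ψ f : H}
    (hf : ∀ k, ((pCoeff ρ (lam k) g T : ℝ) : 𝕜) * inner 𝕜 (v k) f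
      = fourierResidual v lam ρ T φ ψ k) :
    IsInverseSolution A ρ T g φ ψ (seriesSolution v lam ρ g φ f) f ∧
      ∀ t ∈ Icc 0 T, ∀ k, inner 𝕜 (v k) (seriesSolution v lam ρ g φ f t)
        = coordSolution v lam ρ g φ f t k := by
  have hpos : ∀ k, 0 < lam k := fun k => hl₀.trans_le (hlam k)
  have hgc : Continuous g := continuous_iff_continuousAt.2 fun s => (hg s).continuousAt
  obtain ⟨M, hM0, hM, -⟩ := exists_common_bound hgc hgc T
  have hy : ∀ t ∈ Icc 0 T, ∀ k, |mlKernel ρ 1 (lam k) t| ≤ 1 := fun t ht k =>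
    abs_mlKernel_one_le hρ0 hρ1 (hpos k) ht.1
  have hlq' : ∀ t ∈ Icc 0 T, ∀ k, lam k * |sourceResponse ρ (lam k) g t| ≤ M := fun t ht k =>
    abs_volterra_mlKernel_self_le hρ0 hρ1 (hpos k) ht.1 fun s hs => hM s ⟨hs.1, hs.2.trans ht.2⟩
  have hlq : ∀ t ∈ Icc 0 T, ∀ k, |lam k * sourceResponse ρ (lam k) g t| ≤ M := fun t ht k => by
    rw [abs_mul, abs_of_pos (hpos k)]; exact hlq' t ht k
  have hq : ∀ t ∈ Icc 0 T, ∀ k, |sourceResponse ρ (lam k) g t| ≤ M / l₀ := fun t ht k =>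
    abs_le_div_of_mul_abs_le hl₀ (hlam k) (hlq' t ht k)
  have hly : ∀ ε, 0 < ε → ∀ t ∈ Icc ε T, ∀ k,
      |lam k * mlKernel ρ 1 (lam k) t| ≤ ρ * Real.Gamma ρ / ε ^ ρ := fun ε hε t ht k => by
    have ht0 : 0 < t := hε.trans_le ht.1
    rw [abs_of_nonneg (mul_nonneg (hpos k).le (mlKernel_one_nonneg hρ0 hρ1 (hpos k) ht0.le))]
    refine (mul_rpow_mul_mlKernel_one_le hρ0 hρ1 (hpos k) ht0).trans ?_
    exact div_le_div_of_nonneg_left (mul_nonneg hρ0.le (Real.Gamma_pos_of_pos hρ0).le)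
      (Real.rpow_pos_of_pos hε ρ) (Real.rpow_le_rpow hε.le ht.1 hρ0.le)
  have hcy : ∀ k, Continuous (mlKernel ρ 1 (lam k)) := fun k => continuous_mlKernel hρ0 le_rfl _
  have hcq : ∀ k, ContinuousOn (sourceResponse ρ (lam k) g) (Icc 0 T) := fun k =>
    continuousOn_sourceResponse hρ0 _ hgc hT.le
  have hcoord : ∀ t ∈ Icc 0 T, ∀ k, inner 𝕜 (v k) (seriesSolution v lam ρ g φ f t)
      = coordSolution v lam ρ g φ f t k := fun t ht k => by
    rw [seriesSolution, inner_add_right, inner_diagMul v (hy t ht), inner_diagMul v (hq t ht)]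
    rfl
  have hcont : ContinuousOn (seriesSolution v lam ρ g φ f) (Icc 0 T) :=
    (continuousOn_diagMul v (m := fun t k => mlKernel ρ 1 (lam k) t)
      (fun k => (hcy k).continuousOn) hy φ).add
      (continuousOn_diagMul v (m := fun t k => sourceResponse ρ (lam k) g t) hcq hq f)
  set z : ℝ → H := fun t => diagMul v (fun k => lam k * mlKernel ρ 1 (lam k) t) φ
    + diagMul v (fun k => lam k * sourceResponse ρ (lam k) g t) f with hz
  have hzc : ContinuousOn z (Ioc 0 T) := by
    refine continuousOn_Ioc_of_forall_Icc fun ε hε => ?_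
    refine (continuousOn_diagMul v (m := fun t k => lam k * mlKernel ρ 1 (lam k) t)
      (fun k => ((hcy k).continuousOn).const_mul _) (hly ε hε) φ).add
      ((continuousOn_diagMul v (m := fun t k => lam k * sourceResponse ρ (lam k) g t)
        (fun k => (hcq k).const_mul _) hlq f).mono (Icc_subset_Icc_left hε.le))
  refine ⟨⟨hcont, ⟨fun t => g t • f - z t, z, ?_, hzc, fun t ht => ⟨?_, ?_, by simp⟩⟩, ?_, ?_⟩,
    hcoord⟩
  · exact (hgc.continuousOn.smul continuousOn_const).sub hzc
  · have htI : t ∈ Icc 0 T := ⟨ht.1.le, ht.2⟩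
    have hw : g t • f - z t = diagMul v (fun k => -lam k * mlKernel ρ 1 (lam k) t) φ
        + diagMul v (fun k => g t - lam k * sourceResponse ρ (lam k) g t) f := by
      refine v.ext_inner fun k => ?_
      have h1 : ∀ k, |-lam k * mlKernel ρ 1 (lam k) t| ≤ ρ * Real.Gamma ρ / t ^ ρ := fun k => by
        rw [neg_mul, abs_neg]; exact hly t ht.1 t ⟨le_rfl, ht.2⟩ k
      have h2 : ∀ k, |g t - lam k * sourceResponse ρ (lam k) g t| ≤ M + M := fun k =>
        (abs_sub _ _).trans (add_le_add (hM t htI) (hlq t htI k))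
      rw [hz, inner_sub_right, inner_add_right, inner_add_right, inner_real_smul,
        inner_diagMul v (hly t ht.1 t ⟨le_rfl, ht.2⟩), inner_diagMul v (hlq t htI),
        inner_diagMul v h1, inner_diagMul v h2]
      push_cast
      ring
    change HasCaputoDerivAt ρ T _ (g t • f - z t) t
    rw [hw]
    exact (hasCaputoDerivAt_diagMul_mlKernel v hpos hρ0 hρ1 ht.1 φ).add hρ1
      (hasCaputoDerivAt_diagMul_sourceResponse v hl₀ hlam hρ0 hρ1 ht.1 hg hg' f) ht.1
  · refine mem_graph_of_inner_eq hA v hv fun k => ?_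
    have htI : t ∈ Icc 0 T := ⟨ht.1.le, ht.2⟩
    rw [hcoord t htI, coordSolution, hz, inner_add_right,
      inner_diagMul v (hly t ht.1 t ⟨le_rfl, ht.2⟩), inner_diagMul v (hlq t htI)]
    push_cast
    ring
  · refine v.ext_inner fun k => ?_
    rw [hcoord 0 ⟨le_rfl, hT.le⟩, coordSolution, mlKernel_one_zero hρ0, sourceResponse_zero]
    simp
  · refine v.ext_inner fun k => ?_
    rw [inner_integral_of_coord v hρ0 hT.le hgc hcont hcoord, hf, fourierResidual_eq]
    ring

/-- When `∫₀ᵀ g ≠ 0`, the numbers `(λ_k p_k(T))⁻¹` converge and hence are bounded, only finitely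
many `p_k(T)` vanish, and the prescribed coefficients are those of a vector of `H`. -/
theorem exists_source [CompleteSpace H] {A : H →ₗ.[𝕜] H}
    (hA : IsSelfAdjoint A) (v : HilbertBasis ℕ 𝕜 H) {lam : ℕ → ℝ}
    (hv : ∀ k, (v k, (lam k : 𝕜) • v k) ∈ A.graph) (hlam : ∀ k, 0 < lam k)
    (hlam_top : Tendsto lam atTop atTop) {ρ T : ℝ}
    (hρ0 : 0 < ρ) (hρ1 : ρ ≤ 1) (hT : 0 < T) {g : ℝ → ℝ} (hgc : Continuous g)
    (hint : (∫ t in (0 : ℝ)..T, g t) ≠ 0) (φ : H) {ψ : H} (hψ : ψ ∈ A.domain) (c : ℕ → 𝕜) :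
    ∃ f : H, ∀ k, inner 𝕜 (v k) f = if pCoeff ρ (lam k) g T = 0 then c k
      else ((pCoeff ρ (lam k) g T)⁻¹ : 𝕜) * fourierResidual v lam ρ T φ ψ k := by
  obtain ⟨C, hC0, hC⟩ := exists_mul_mlKernel_two_le hρ0 hρ1 hT
  obtain ⟨M, hM0, hM, -⟩ := exists_common_bound hgc hgc T
  have hlim : Tendsto (fun k => lam k * pCoeff ρ (lam k) g T) atTop
      (𝓝 (∫ t in (0 : ℝ)..T, g t)) := by
    rw [tendsto_iff_norm_sub_tendsto_zero]
    refine squeeze_zero (fun _ => norm_nonneg _)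
      (fun k => abs_mul_pCoeff_sub_le hρ0 hρ1 (hlam k) hT.le hgc hM (hC _ (hlam k))) ?_
    exact tendsto_const_nhds.div_atTop hlam_top
  -- For the finitely many `k` with `p_k(T) = 0` the inverse is `0`, so that the two diagonal terms
  -- below contribute nothing there; the vector `e` carries the free coefficients.
  obtain ⟨D, hD⟩ := (Metric.isBounded_range_of_tendsto _ (hlim.inv₀ hint)).exists_norm_le
  have hD' : ∀ k, |(lam k * pCoeff ρ (lam k) g T)⁻¹| ≤ D := fun k => hD _ ⟨k, rfl⟩
  obtain ⟨z, hz⟩ : ∃ z, (ψ, z) ∈ A.graph :=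
    ⟨A ⟨ψ, hψ⟩, (LinearPMap.mem_graph_iff A).2 ⟨⟨ψ, hψ⟩, rfl, rfl⟩⟩
  have hE : ∀ k, |-(lam k * pCoeff ρ (lam k) g T)⁻¹ * (lam k * mlKernel ρ 2 (lam k) T)|
      ≤ D * C := fun k => by
    rw [abs_mul, abs_neg, abs_of_nonneg (mul_nonneg (hlam k).le
      (mlKernel_two_nonneg hρ0 hρ1 (hlam k) hT.le))]
    exact mul_le_mul (hD' k) (hC _ (hlam k)) (mul_nonneg (hlam k).le
      (mlKernel_two_nonneg hρ0 hρ1 (hlam k) hT.le)) ((abs_nonneg _).trans (hD' k))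
  have hev : ∀ᶠ k in atTop, pCoeff ρ (lam k) g T ≠ 0 := by
    filter_upwards [hlim.eventually_ne hint] with k hk h0
    exact hk (by rw [h0, mul_zero])
  obtain ⟨e, he⟩ := v.exists_inner_eq
    (a := fun k => if pCoeff ρ (lam k) g T = 0 then c k else 0) (by
      refine summable_of_hasFiniteSupport ?_
      refine (Nat.cofinite_eq_atTop ▸ hev : ∀ᶠ k in cofinite, _).subset fun k hk => ?_
      simp only [Function.mem_support] at hk
      by_contra h
      exact hk (by rw [if_neg (by simpa using h)]; simp))
  refine ⟨diagMul v (fun k => (lam k * pCoeff ρ (lam k) g T)⁻¹) z + diagMul v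
    (fun k => -(lam k * pCoeff ρ (lam k) g T)⁻¹ * (lam k * mlKernel ρ 2 (lam k) T)) φ + e,
    fun k => ?_⟩
  rw [inner_add_right, inner_add_right, inner_diagMul v hD', inner_diagMul v hE, he,
    inner_eigenvector_graph hA (hv k) hz, fourierResidual_eq]
  split_ifs with h0
  · simp [h0]
  · have h1 : ((lam k : ℝ) : 𝕜) ≠ 0 := RCLike.ofReal_ne_zero.2 (hlam k).ne'
    have h2 : ((pCoeff ρ (lam k) g T : ℝ) : 𝕜) ≠ 0 := RCLike.ofReal_ne_zero.2 h0
    push_cast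
    field_simp
    ring

end Solutions

/-! ### Dependence on the source factor only through its values on the time interval -/

theorem sourceResponse_congr {g G : ℝ → ℝ} {T t : ℝ} (h : EqOn g G (Icc 0 T)) (ht : t ∈ Icc 0 T)
    (ρ l : ℝ) : sourceResponse ρ l g t = sourceResponse ρ l G t := by
  refine intervalIntegral.integral_congr fun s hs => ?_
  rw [uIcc_of_le ht.1] at hs
  rw [h ⟨hs.1, hs.2.trans ht.2⟩]

theorem pCoeff_congr {g G : ℝ → ℝ} {T : ℝ} (hT : 0 ≤ T) (h : EqOn g G (Icc 0 T)) (ρ l : ℝ) :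
    pCoeff ρ l g T = pCoeff ρ l G T := by
  refine intervalIntegral.integral_congr fun s hs => ?_
  rw [uIcc_of_le hT] at hs
  rw [h hs]

section Congr

variable {𝕜 H : Type*} [RCLike 𝕜] [NormedAddCommGroup H] [InnerProductSpace 𝕜 H]

theorem isInverseSolution_congr [NormedSpace ℝ H] {A : H →ₗ.[𝕜] H} {g G : ℝ → ℝ} {ρ T : ℝ}
    (h : EqOn g G (Icc 0 T)) (φ ψ : H) (u : ℝ → H) (f : H) :
    IsInverseSolution A ρ T g φ ψ u f ↔ IsInverseSolution A ρ T G φ ψ u f := by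
  constructor
  · rintro ⟨h1, ⟨w, z, hw, hz, he⟩, h3, h4⟩
    exact ⟨h1, ⟨w, z, hw, hz, fun t ht => ⟨(he t ht).1, (he t ht).2.1, by
      rw [(he t ht).2.2, h ⟨ht.1.le, ht.2⟩]⟩⟩, h3, h4⟩
  · rintro ⟨h1, ⟨w, z, hw, hz, he⟩, h3, h4⟩
    exact ⟨h1, ⟨w, z, hw, hz, fun t ht => ⟨(he t ht).1, (he t ht).2.1, by
      rw [(he t ht).2.2, h ⟨ht.1.le, ht.2⟩]⟩⟩, h3, h4⟩

theorem isGivenBySeries_congr {v : HilbertBasis ℕ 𝕜 H} {lam : ℕ → ℝ} {g G : ℝ → ℝ} {ρ T : ℝ}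
    (h : EqOn g G (Icc 0 T)) (φ : H) (a : ℕ → 𝕜) (u : ℝ → H) (f : H) :
    IsGivenBySeries v lam ρ T g φ a u f ↔ IsGivenBySeries v lam ρ T G φ a u f := by
  unfold IsGivenBySeries
  refine and_congr_right fun _ => forall₂_congr fun t ht => ?_
  simp only [sourceResponse_congr h ht]

end Congr

/-- `G` keeps the sign of `G 0` near `0`. -/
theorem exists_pos_integral_ne_zero {G : ℝ → ℝ} (hG : Continuous G) (h0 : G 0 ≠ 0) :
    ∃ m₀ : ℝ, 0 < m₀ ∧ ∀ T, 0 < T → T ≤ m₀ → (∫ t in (0 : ℝ)..T, G t) ≠ 0 := by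
  have hev : ∀ᶠ s in 𝓝 (0 : ℝ), 0 < G 0 * G s :=
    (continuous_const.mul hG).continuousAt.eventually (Ioi_mem_nhds (mul_self_pos.2 h0))
  obtain ⟨δ, hδ, hball⟩ := Metric.eventually_nhds_iff_ball.1 hev
  refine ⟨δ, hδ, fun T hT hTδ hz => ?_⟩
  have hpos : 0 < ∫ s in (0 : ℝ)..T, G 0 * G s := by
    refine intervalIntegral.intervalIntegral_pos_of_pos_on
      ((continuous_const.mul hG).intervalIntegrable _ _) (fun s hs => hball s ?_) hT
    rw [mem_ball_zero_iff, Real.norm_of_nonneg hs.1.le]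
    exact hs.2.trans_le hTδ
  rw [intervalIntegral.integral_const_mul, hz, mul_zero] at hpos
  exact lt_irrefl _ hpos

/-! ### The inverse problem -/

theorem mainTheorem2 {𝕜 H : Type*} [RCLike 𝕜] [NormedAddCommGroup H]
    [InnerProductSpace 𝕜 H] [NormedSpace ℝ H] [CompleteSpace H]
    (A : H →ₗ.[𝕜] H) (hA : IsSelfAdjoint A)
    (hApos : ∃ C : ℝ, 0 < C ∧
      ∀ x : A.domain, C * ‖(x : H)‖ ^ 2 ≤ RCLike.re (inner 𝕜 (A x) (x : H)))
    (v : HilbertBasis ℕ 𝕜 H) (lam : ℕ → ℝ)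
    (hv : ∀ k, (v k, (lam k : 𝕜) • v k) ∈ A.graph)
    (hlam_pos : ∀ k, 0 < lam k) (hlam_mono : Monotone lam)
    (hlam_top : Tendsto lam atTop atTop)
    (ρ : ℝ) (hρ0 : 0 < ρ) (hρ1 : ρ ≤ 1)
    (T₀ : ℝ) (hT₀ : 0 < T₀) (g : ℝ → ℝ) (hg : ContDiffOn ℝ 1 g (Icc 0 T₀)) (hg0 : g 0 ≠ 0) :
    ∃ m₀ : ℝ, 0 < m₀ ∧ ∀ T : ℝ, 0 < T → T ≤ T₀ →
      (T ≤ m₀ ∨ (∫ t in (0 : ℝ)..T, g t) ≠ 0) →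
      ∀ φ ψ : H, ψ ∈ A.domain →
      -- first case: no `p_k(T)` vanishes
      ({k : ℕ | pCoeff ρ (lam k) g T = 0} = ∅ →
        ∃ (u : ℝ → H) (f : H), IsInverseSolution A ρ T g φ ψ u f ∧
          IsGivenBySeries v lam ρ T g φ
            (fun k => ((pCoeff ρ (lam k) g T)⁻¹ : 𝕜) * fourierResidual v lam ρ T φ ψ k) u f ∧
          ∀ (u' : ℝ → H) (f' : H), IsInverseSolution A ρ T g φ ψ u' f' →
            f' = f ∧ EqOn u' u (Icc 0 T)) ∧
      -- second case: some `p_k(T)` vanishes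
      ({k : ℕ | pCoeff ρ (lam k) g T = 0}.Nonempty →
        -- solvability criterion
        ((∃ (u : ℝ → H) (f : H), IsInverseSolution A ρ T g φ ψ u f) ↔
          ∀ k, pCoeff ρ (lam k) g T = 0 →
            inner 𝕜 (v k) ψ =
              inner 𝕜 (v k) φ * ((T * mittagLeffler ρ 2 (-lam k * T ^ ρ) : ℝ) : 𝕜)) ∧
        ((∀ k, pCoeff ρ (lam k) g T = 0 →
            inner 𝕜 (v k) ψ =
              inner 𝕜 (v k) φ * ((T * mittagLeffler ρ 2 (-lam k * T ^ ρ) : ℝ) : 𝕜)) →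
          -- the solution is not unique
          (∃ (u₁ u₂ : ℝ → H) (f₁ f₂ : H), IsInverseSolution A ρ T g φ ψ u₁ f₁ ∧
            IsInverseSolution A ρ T g φ ψ u₂ f₂ ∧ f₁ ≠ f₂) ∧
          -- every choice of the free coefficients gives a solution
          (∀ c : ℕ → 𝕜, ∃ (u : ℝ → H) (f : H), IsInverseSolution A ρ T g φ ψ u f ∧
            IsGivenBySeries v lam ρ T g φ
              (fun k => if pCoeff ρ (lam k) g T = 0 then c k
                else ((pCoeff ρ (lam k) g T)⁻¹ : 𝕜) * fourierResidual v lam ρ T φ ψ k) u f) ∧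
          -- and every solution arises in this way
          (∀ (u : ℝ → H) (f : H), IsInverseSolution A ρ T g φ ψ u f →
            ∃ c : ℕ → 𝕜, IsGivenBySeries v lam ρ T g φ
              (fun k => if pCoeff ρ (lam k) g T = 0 then c k
                else ((pCoeff ρ (lam k) g T)⁻¹ : 𝕜) * fourierResidual v lam ρ T φ ψ k) u f))) := by
  have hl₀ := hlam_pos 0
  have hlam : ∀ k, lam 0 ≤ lam k := fun k => hlam_mono (Nat.zero_le k)
  -- only the values of `g` on `[0, T₀]` matter, so `g` is replaced by a `C¹` function on `ℝ`
  obtain ⟨G, G', hG, hG', hGg⟩ := exists_hasDerivAt_extension hT₀ hg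
  have hGc : Continuous G := continuous_iff_continuousAt.2 fun s => (hG s).continuousAt
  obtain ⟨m₀, hm₀, hint₀⟩ := exists_pos_integral_ne_zero hGc
    (by rwa [hGg ⟨le_rfl, hT₀.le⟩])
  refine ⟨m₀, hm₀, fun T hT hTT₀ hor φ ψ hψ => ?_⟩
  have hgG : EqOn g G (Icc 0 T) := fun t ht => (hGg ⟨ht.1, ht.2.trans hTT₀⟩).symm
  have hint : (∫ t in (0 : ℝ)..T, G t) ≠ 0 := by
    rcases hor with h | h
    · exact hint₀ T hT h
    · convert h using 1
      refine intervalIntegral.integral_congr fun t ht => ?_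
      rw [uIcc_of_le hT.le] at ht
      exact (hgG ht).symm
  simp only [pCoeff_congr hT.le hgG, isInverseSolution_congr hgG, isGivenBySeries_congr hgG]
  set p : ℕ → ℝ := fun k => pCoeff ρ (lam k) G T with hp
  set res : ℕ → 𝕜 := fun k => fourierResidual v lam ρ T φ ψ k with hres
  -- solvability for every choice of the free coefficients
  have hexists : ∀ c : ℕ → 𝕜, (∀ k, p k = 0 → res k = 0) →
      ∃ (u : ℝ → H) (f : H), IsInverseSolution A ρ T G φ ψ u f ∧
        (∀ k, inner 𝕜 (v k) f = if p k = 0 then c k else ((p k)⁻¹ : 𝕜) * res k) ∧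
        IsGivenBySeries v lam ρ T G φ
          (fun k => if p k = 0 then c k else ((p k)⁻¹ : 𝕜) * res k) u f := by
    intro c hc
    obtain ⟨f, hf⟩ := exists_source hA v hv hlam_pos hlam_top hρ0 hρ1 hT hGc hint φ hψ c
    have hf' : ∀ k, ((p k : ℝ) : 𝕜) * inner 𝕜 (v k) f = res k := fun k => by
      rw [hf]
      by_cases h0 : p k = 0
      · rw [h0, hc k h0]; simp
      · rw [if_neg h0, mul_inv_cancel_left₀ (RCLike.ofReal_ne_zero.2 h0)]
    obtain ⟨hsol, hcoord⟩ :=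
      isInverseSolution_seriesSolution hA v hl₀ hv hlam hρ0 hρ1 hT hG hG' hf'
    exact ⟨_, f, hsol, hf, isGivenBySeries_of_coord v (fun k => (hf k).symm) hcoord⟩
  -- the coefficients of an arbitrary solution
  have hcoeff : ∀ (u : ℝ → H) (f : H), IsInverseSolution A ρ T G φ ψ u f →
      ∀ k, ((p k : ℝ) : 𝕜) * inner 𝕜 (v k) f = res k := fun u f h k =>
    h.pCoeff_mul_inner hA v hv hlam_pos hρ0 hρ1 hT hG hG' k
  have hinv : ∀ (u : ℝ → H) (f : H), IsInverseSolution A ρ T G φ ψ u f →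
      ∀ k, p k ≠ 0 → inner 𝕜 (v k) f = ((p k)⁻¹ : 𝕜) * res k := fun u f h k h0 => by
    rw [← hcoeff u f h k, inv_mul_cancel_left₀ (RCLike.ofReal_ne_zero.2 h0)]
  have hcond : (∀ k, p k = 0 → inner 𝕜 (v k) ψ =
      inner 𝕜 (v k) φ * ((T * mittagLeffler ρ 2 (-lam k * T ^ ρ) : ℝ) : 𝕜)) ↔
      ∀ k, p k = 0 → res k = 0 :=
    forall₂_congr fun k _ => sub_eq_zero.symm
  constructor
  · intro hempty
    have hp0 : ∀ k, p k ≠ 0 := fun k hk => by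
      have : k ∈ {k : ℕ | p k = 0} := hk
      rw [hempty] at this
      exact this
    obtain ⟨u, f, hsol, hf, hser⟩ := hexists 0 fun k hk => absurd hk (hp0 k)
    refine ⟨u, f, hsol, by simpa only [hp0, if_false] using hser, fun u' f' hsol' => ?_⟩
    have hff : f' = f := v.ext_inner fun k => by
      rw [hinv u' f' hsol' k (hp0 k), hinv u f hsol k (hp0 k)]
    subst hff
    refine ⟨rfl, fun t ht => v.ext_inner fun k => ?_⟩
    rw [hsol'.inner_eq hA v hv hlam_pos hρ0 hρ1 hT hG hG' t ht,
      hsol.inner_eq hA v hv hlam_pos hρ0 hρ1 hT hG hG' t ht]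
  · rintro ⟨k₀, hk₀⟩
    have hk₀ : p k₀ = 0 := hk₀
    rw [hcond]
    refine ⟨⟨?_, fun h => ?_⟩, fun h => ⟨?_, fun c => ?_, fun u f hsol => ?_⟩⟩
    · rintro ⟨u, f, hsol⟩ k hk
      rw [← hcoeff u f hsol k, hk]; simp
    · obtain ⟨u, f, hsol, -, -⟩ := hexists 0 h
      exact ⟨u, f, hsol⟩
    · obtain ⟨u₁, f₁, hsol₁, hf₁, -⟩ := hexists (fun _ => 0) h
      obtain ⟨u₂, f₂, hsol₂, hf₂, -⟩ := hexists (fun _ => 1) h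
      refine ⟨u₁, u₂, f₁, f₂, hsol₁, hsol₂, fun heq => ?_⟩
      have h1 := hf₁ k₀
      rw [heq, hf₂, if_pos hk₀, if_pos hk₀] at h1
      exact one_ne_zero h1
    · obtain ⟨u, f, hsol, -, hser⟩ := hexists c h
      exact ⟨u, f, hsol, hser⟩
    · refine ⟨fun k => inner 𝕜 (v k) f, isGivenBySeries_of_coord v (fun k => ?_)
        (hsol.inner_eq hA v hv hlam_pos hρ0 hρ1 hT hG hG')⟩
      split_ifs with h0
      · rfl
      · exact (hinv u f hsol k h0).symm
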